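/- Let $N\in\mathbb N$, $h\in\mathbb R$, $t\ge 0$, and let $(g_{ij})_{1\le i<j\le N}$ be i.i.d. centered Gaussian random variables of variance $t/N$; set $g_{ji}=g_{ij}$ and $g_{ii}=0$. For $A\subset\{1,\dots,N\}$ and $\tau\in\{-1,1\}^{A}$ define, for $\sigma\in\{-1,1\}^{\{1,\dots,N\}\setminus A}$, $$H_N^{[A]}(\sigma)=\sum_{\substack{1\le i<j\le N\\ i,j\notin A}} g_{ij}\sigma_i\sigma_j+\sum_{i\notin A}\Big(h+\sum_{j\in A}g_{ij}\tau_j\Big)\sigma_i,$$ let $\langle f\rangle^{[A]}=\sum_\sigma f(\sigma)e^{H_N^{[A]}(\sigma)}\big/\sum_\sigma e^{H_N^{[A]}(\sigma)}$ be the corresponding Gibbs expectation (the SK model conditioned on the spins in $A$ being equal to $\tau$), and for $i,j,k\notin A$ let $$m_{ijk}^{[A]}=\Big\langle\big(\sigma_i-\langle\sigma_i\rangle^{[A]}\big)\big(\sigma_j-\langle\sigma_j\rangle^{[A]}\big)\big(\sigma_k-\langle\sigma_k\rangle^{[A]}\big)\Big\rangle^{[A]}.$$ **Lemma 3.2.**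 For every sufficiently small $\epsilon>0$ there is a constant $C_\epsilon>0$, depending only on $\epsilon$ (in particular independent of $N$, $t$, $h$ and $A$), such that for all $0\le t<\log 2$, all $h\in\mathbb R$, all $N\in\mathbb N$, all $A\subset\{1,\dots,N\}$ and all pairwise distinct $i,j,k\in\{1,\dots,N\}\setminus A$, $$\sup_{\tau\in\{-1,1\}^{A}}\mathbb E\,\big|m_{ijk}^{[A]}\big|^2\le\frac{C_\epsilon}{N^{1+\epsilon/2}}.$$ The smallness required of $\epsilon$ is likewise uniform in $t$, $h$, $N$ and $A$. -/

import Mathlib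

open MeasureTheory ProbabilityTheory

namespace SK

noncomputable section

/-- A spin is an element of `{-1, 1}`, modelled as a unit of `ℤ`. -/
abbrev Spin : Type := ℤˣ

/-- The real number `±1` represented by a spin. -/
def Spin.val (s : Spin) : ℝ := ((s : ℤ) : ℝ)

/-- The couplings of the `N`-spin model at parameter `t`: random variables `g i j`, symmetric in
`i` and `j`, zero on the diagonal, such that the `g i j` with `i < j` are independent centered
Gaussians of variance `t / N`. -/
structure IsCoupling {Ω : Type*} [MeasurableSpace Ω] (P : Measure Ω) (t : ℝ) {N : ℕ}
    (g : Fin N → Fin N → Ω → ℝ) : Prop where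
  measurable : ∀ i j, Measurable (g i j)
  symm : ∀ i j, g i j = g j i
  diag : ∀ i, g i i = 0
  law : ∀ i j, i < j → P.map (g i j) = gaussianReal 0 (t / N).toNNReal
  indep : iIndepFun (fun p : {p : Fin N × Fin N // p.1 < p.2} => g p.1.1 p.1.2) P

section Gibbs

variable {N : ℕ}

/-- Configurations `τ` of the spins with index in `A`. -/
abbrev Fixed (A : Finset (Fin N)) : Type := {i : Fin N // i ∈ A} → Spin

/-- Configurations `σ` of the spins with index outside `A`. -/
abbrev Config (A : Finset (Fin N)) : Type := {i : Fin N // i ∉ A} → Spin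

/-- The reduced Hamiltonian `H_N^{[A]}` with couplings `g` and external field `h`: the energy of
the spins outside `A` when the spins in `A` are frozen to `τ`. -/
def hamiltonian (g : Fin N → Fin N → ℝ) (h : ℝ) (A : Finset (Fin N)) (τ : Fixed A)
    (σ : Config A) : ℝ :=
  (∑ i : {i : Fin N // i ∉ A}, ∑ j : {j : Fin N // j ∉ A},
      if i.1 < j.1 then g i.1 j.1 * (σ i).val * (σ j).val else 0)
    + ∑ i : {i : Fin N // i ∉ A},
        (h + ∑ j : {j : Fin N // j ∈ A}, g i.1 j.1 * (τ j).val) * (σ i).val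

/-- The Gibbs expectation `⟨f⟩^{[A]}` of an observable `f`. -/
def gibbs (g : Fin N → Fin N → ℝ) (h : ℝ) (A : Finset (Fin N)) (τ : Fixed A)
    (f : Config A → ℝ) : ℝ :=
  (∑ σ : Config A, f σ * Real.exp (hamiltonian g h A τ σ))
    / ∑ σ : Config A, Real.exp (hamiltonian g h A τ σ)

/-- The magnetization `m_i^{[A]} = ⟨σ_i⟩^{[A]}`. -/
def magnetization (g : Fin N → Fin N → ℝ) (h : ℝ) (A : Finset (Fin N)) (τ : Fixed A)
    (i : {i : Fin N // i ∉ A}) : ℝ :=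
  gibbs g h A τ (fun σ => (σ i).val)

/-- The three-point function
`m_{ijk}^{[A]} = ⟨(σ_i - ⟨σ_i⟩^{[A]}) (σ_j - ⟨σ_j⟩^{[A]}) (σ_k - ⟨σ_k⟩^{[A]})⟩^{[A]}`. -/
def threePoint (g : Fin N → Fin N → ℝ) (h : ℝ) (A : Finset (Fin N)) (τ : Fixed A)
    (i j k : {i : Fin N // i ∉ A}) : ℝ :=
  gibbs g h A τ (fun σ =>
    ((σ i).val - magnetization g h A τ i) * ((σ j).val - magnetization g h A τ j)
      * ((σ k).val - magnetization g h A τ k))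

end Gibbs

end

end SK

namespace SK

noncomputable section

open scoped NNReal

/-! Two mechanisms drive the proof: conditioning on one spin, and a Gaussian Poincaré inequality in
the couplings of that spin. If spin `i` is set to ±1, the other spins form a system of the same kind
whose field is shifted by ±`J s(i, l)`. By total expectation, every joint cumulant containing `σ_i`
is controlled by half-differences between the two conditioned systems: the covariance with `σ_j` is
`4pq` times `magDiff`, and the third cumulant is a combination of `covDiff` and a product of two
`magDiff`s (`abs_cov_insert_le`, `abs_cum3_insert_le`).

These half-differences are odd in the couplings of `i`, hence centered, and those couplings are
independent of the ones inside the remaining system. Poincaré therefore bounds their moments by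
those of their gradients. Differentiating in the field raises the order of a cumulant by one, so the
gradient of `magDiff` consists of averaged covariances, and that of `covDiff` of averaged third
cumulants, of the system without `i`. The sum over at most `n` coordinates is offset by the
variance, of order `1/n`. What remains is the factor `π²/8 · t`, at most `0.86` for `t < log 2`;
being below 1, it lets an induction on the set of interacting spins close with constants that do not
grow.

For covariances the induction is run on `p`-th moments with `p = 2 + ε`
(`integral_abs_cov_rpow_le`), applying Poincaré to the signed power `D|D|^(p/2-1)`. Young's
inequality splits the gradient; its extra multiple of the left side is absorbed because `p - 2` is
small. The result is the bound `10 n^(-p/2)`.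

For third cumulants the induction is on second moments (`integral_cum3_sq_le`). Gradient terms with
a repeated index reduce to covariances. Since `|D| ≤ 1` and `p ≤ 4`, the squared product of two
`magDiff`s is bounded by their `p`-th moments; this is where the gain beyond `1/N` originates.

All bounds are uniform in a deterministic, site-dependent field. The field created by the spins
frozen in `A` is independent of the couplings outside `A`, so it may be held fixed. -/

/-- The law of a family of independent centered Gaussian variables of variance `v`. -/
abbrev gaussianPi (ι : Type*) [Fintype ι] (v : ℝ≥0) : Measure (ι → ℝ) :=
  Measure.pi fun _ => gaussianReal 0 v

/-! ### Product measures: marginals and resampling of coordinates -/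

section Product

variable {ι κ : Type*} [Fintype ι] [Fintype κ]

/-- Used to realise the couplings with `i < j` as a subfamily of an i.i.d. family indexed by all
unordered pairs. -/
lemma measurePreserving_comp_injective {α : Type*} [MeasurableSpace α] (μ : Measure α)
    [IsProbabilityMeasure μ] {e : κ → ι} (he : Function.Injective e) :
    MeasurePreserving (fun (y : ι → α) k => y (e k)) (Measure.pi fun _ => μ)
      (Measure.pi fun _ => μ) := by
  classical
  have hm : Measurable (fun (y : ι → α) k => y (e k)) := by fun_prop
  refine ⟨hm, (Measure.pi_eq fun s hs => ?_).symm⟩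
  rw [Measure.map_apply hm (MeasurableSet.univ_pi hs)]
  have : (fun (y : ι → α) k => y (e k)) ⁻¹' (Set.univ.pi s)
      = Set.univ.pi (Function.extend e s fun _ => Set.univ) := by
    ext y
    simp only [Set.mem_preimage, Set.mem_pi, Set.mem_univ, true_imp_iff]
    constructor
    · intro h i
      by_cases hi : ∃ k, e k = i
      · obtain ⟨k, rfl⟩ := hi
        rw [he.extend_apply]
        exact h k
      · rw [Function.extend_apply' _ _ _ hi]
        trivial
    · intro h k
      have := h (e k)
      rwa [he.extend_apply] at this
  rw [this, Measure.pi_pi, ← Finset.prod_subset (Finset.subset_univ (Finset.univ.image e)),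
    Finset.prod_image he.injOn]
  · simp [he.extend_apply]
  · intro i _ hi
    rw [Function.extend_apply' _ _ _ (by simpa using hi)]
    simp

/-- Overwriting the block `S` by an independent copy does not change the law. This is the form in
which independence of two blocks of couplings is used. -/
lemma measurePreserving_piecewise {α : Type*} [MeasurableSpace α] (μ : Measure α)
    [IsProbabilityMeasure μ] (S : Set ι) [DecidablePred (· ∈ S)] :
    MeasurePreserving (fun q : (ι → α) × (ι → α) => S.piecewise q.2 q.1)
      ((Measure.pi fun _ => μ).prod (Measure.pi fun _ => μ)) (Measure.pi fun _ => μ) := by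
  have hm : Measurable (fun q : (ι → α) × (ι → α) => S.piecewise q.2 q.1) := by
    refine measurable_pi_lambda _ fun i => ?_
    by_cases hi : i ∈ S
    · simp only [Set.piecewise, hi, if_true]; fun_prop
    · simp only [Set.piecewise, hi, if_false]; fun_prop
  refine ⟨hm, (Measure.pi_eq fun s hs => ?_).symm⟩
  rw [Measure.map_apply hm (MeasurableSet.univ_pi hs)]
  have : (fun q : (ι → α) × (ι → α) => S.piecewise q.2 q.1) ⁻¹' (Set.univ.pi s)
      = (Set.univ.pi fun i => if i ∈ S then Set.univ else s i)
        ×ˢ (Set.univ.pi fun i => if i ∈ S then s i else Set.univ) := by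
    ext q
    simp only [Set.mem_preimage, Set.mem_pi, Set.mem_univ, true_imp_iff, Set.mem_prod,
      ← forall_and]
    refine forall_congr' fun i => ?_
    by_cases hi : i ∈ S <;> simp [hi, Set.piecewise]
  rw [this, Measure.prod_prod, Measure.pi_pi, Measure.pi_pi, ← Finset.prod_mul_distrib]
  refine Finset.prod_congr rfl fun i _ => ?_
  by_cases hi : i ∈ S <;> simp [hi]

end Product

/-! ### Gaussian Poincaré inequality by rotations -/

section Gaussian

variable {ι κ : Type*} [Fintype ι] (v : ℝ≥0)

lemma iIndepFun_eval_gaussianPi :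
    iIndepFun (fun (i : ι) (y : ι → ℝ) => y i) (gaussianPi ι v) :=
  iIndepFun_pi (X := fun (_ : ι) (a : ℝ) => a) fun _ => aemeasurable_id

lemma map_eval_gaussianPi (i : ι) :
    (gaussianPi ι v).map (fun y => y i) = gaussianReal 0 v :=
  (measurePreserving_eval (fun _ => gaussianReal 0 v) i).map_eq

instance isGaussian_gaussianPi : IsGaussian (gaussianPi ι v) := by
  have h := iIndepFun.hasGaussianLaw (P := gaussianPi ι v)
    (X := fun (i : ι) (y : ι → ℝ) => y i) (fun i => ⟨by
      rw [map_eval_gaussianPi]; infer_instance⟩) (iIndepFun_eval_gaussianPi v)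
  have := h.isGaussian_map
  simpa using this

lemma memLp_eval_gaussianPi (i : ι) : MemLp (fun y : ι → ℝ => y i) 2 (gaussianPi ι v) := by
  have h : MemLp (id : ℝ → ℝ) 2 ((gaussianPi ι v).map (fun y => y i)) := by
    rw [map_eval_gaussianPi]
    exact IsGaussian.memLp_id _ 2 (by simp)
  exact h.comp_of_map (measurable_pi_apply i).aemeasurable

lemma integral_eval_gaussianPi (i : ι) : ∫ y, y i ∂(gaussianPi ι v) = 0 := by
  have := integral_map (μ := gaussianPi ι v) (φ := fun y => y i) (f := fun a : ℝ => a)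
    (measurable_pi_apply i).aemeasurable (by fun_prop)
  rw [← this, map_eval_gaussianPi, integral_id_gaussianReal]

lemma integral_eval_sq_gaussianPi (i : ι) : ∫ y, y i * y i ∂(gaussianPi ι v) = v := by
  have h := variance_id_gaussianReal (μ := 0) (v := v)
  rw [variance_eq_integral (by fun_prop)] at h
  simp only [id, integral_id_gaussianReal, sub_zero] at h
  have := integral_map (μ := gaussianPi ι v) (φ := fun y => y i) (f := fun a : ℝ => a ^ 2)
    (measurable_pi_apply i).aemeasurable (by fun_prop)
  rw [map_eval_gaussianPi, h] at this
  simpa [pow_two] using this.symm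

lemma integral_eval_mul_eval_gaussianPi {i j : ι} (hij : i ≠ j) :
    ∫ y, y i * y j ∂(gaussianPi ι v) = 0 := by
  have h := ((iIndepFun_eval_gaussianPi (ι := ι) v).indepFun hij).integral_mul_eq_mul_integral
    (measurable_pi_apply i).aestronglyMeasurable (measurable_pi_apply j).aestronglyMeasurable
  simp only [Pi.mul_apply] at h
  simpa [integral_eval_gaussianPi] using h

lemma integral_sum_sq_gaussianPi (s : Finset κ) {e : κ → ι} (he : Set.InjOn e s) (a : κ → ℝ) :
    ∫ y, (∑ l ∈ s, a l * y (e l)) ^ 2 ∂(gaussianPi ι v) = v * ∑ l ∈ s, a l ^ 2 := by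
  classical
  have hint : ∀ l m : κ, Integrable (fun y : ι → ℝ => a l * y (e l) * (a m * y (e m)))
      (gaussianPi ι v) := fun l m => by
    have := ((memLp_eval_gaussianPi v (e l)).const_mul (a l)).integrable_mul
      ((memLp_eval_gaussianPi v (e m)).const_mul (a m))
    exact this
  simp_rw [pow_two, Finset.sum_mul_sum]
  rw [integral_finsetSum _ fun l _ => integrable_finsetSum _ fun m _ => hint l m, Finset.mul_sum]
  refine Finset.sum_congr rfl fun l hl => ?_
  rw [integral_finsetSum _ fun m _ => hint l m, Finset.sum_eq_single l]
  · have : ∀ y : ι → ℝ, a l * y (e l) * (a l * y (e l)) = (a l * a l) * (y (e l) * y (e l)) :=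
      fun y => by ring
    simp_rw [this, integral_const_mul, integral_eval_sq_gaussianPi]
    ring
  · intro m hm hml
    have : ∀ y : ι → ℝ, a l * y (e l) * (a m * y (e m)) = (a l * a m) * (y (e l) * y (e m)) :=
      fun y => by ring
    simp_rw [this, integral_const_mul]
    rw [integral_eval_mul_eval_gaussianPi v fun h => hml (he hm hl h.symm)]
    simp
  · exact fun h => absurd hl h

lemma map_rotation_gaussianPi (θ : ℝ) :
    ((gaussianPi ι v).prod (gaussianPi ι v)).map (ContinuousLinearMap.rotation θ)
      = (gaussianPi ι v).prod (gaussianPi ι v) := by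
  classical
  refine IsGaussian.map_rotation_eq_self_of_forall_strongDual_eq_zero (fun L => ?_) θ
  have : ∀ y : ι → ℝ, L y = ∑ i, y i * L (fun j => if i = j then 1 else 0) := fun y => by
    simpa using L.toLinearMap.pi_apply_eq_sum_univ y
  rw [integral_congr_ae (Filter.Eventually.of_forall this)]
  rw [integral_finsetSum _ fun i _ =>
    ((memLp_eval_gaussianPi v i).integrable (by norm_num)).mul_const _]
  simp [integral_mul_const, integral_eval_gaussianPi]

/-- The first component of the rotated pair moves from `p.1` to `p.2` as `θ` runs over `[0, π/2]`,
with velocity the second component. The bound is the fundamental theorem of calculus followed by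
Cauchy–Schwarz, which costs the length `π/2`. -/
lemma sq_sub_le_integral_rotation (s : Finset κ) {e : κ → ι} {F : (ι → ℝ) → ℝ}
    {u : κ → (ι → ℝ) → ℝ}
    (hF : ∀ x, HasFDerivAt F
      (∑ l ∈ s, u l x • (ContinuousLinearMap.proj (R := ℝ) (φ := fun _ : ι => ℝ) (e l))) x)
    (hu : ∀ l ∈ s, Continuous (u l)) (p : (ι → ℝ) × (ι → ℝ)) :
    (F p.2 - F p.1) ^ 2 ≤ Real.pi / 2 * ∫ θ in (0 : ℝ)..(Real.pi / 2),
      (∑ l ∈ s, u l (ContinuousLinearMap.rotation θ p).1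
        * (ContinuousLinearMap.rotation θ p).2 (e l)) ^ 2 := by
  have hπ := Real.pi_pos
  set G : ℝ → ℝ := fun θ => ∑ l ∈ s, u l (ContinuousLinearMap.rotation θ p).1
    * (ContinuousLinearMap.rotation θ p).2 (e l) with hG
  have hrp : Continuous fun θ : ℝ => ContinuousLinearMap.rotation θ p :=
    by
    simp only [ContinuousLinearMap.rotation_apply]
    fun_prop
  have hGc : Continuous G := by
    refine continuous_finsetSum _ fun l hl => ?_
    exact ((hu l hl).comp (continuous_fst.comp hrp)).mul
      ((continuous_apply (e l)).comp (continuous_snd.comp hrp))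
  have hder : ∀ θ : ℝ, HasDerivAt
      (fun θ => F (ContinuousLinearMap.rotation θ p).1) (G θ) θ := by
    intro θ
    have hc : HasDerivAt (fun θ : ℝ => (ContinuousLinearMap.rotation θ p).1)
        ((ContinuousLinearMap.rotation θ p).2) θ := by
      have h1 := (Real.hasDerivAt_cos θ).smul_const p.1
      have h2 := (Real.hasDerivAt_sin θ).smul_const p.2
      exact h1.add h2
    have := (hF (ContinuousLinearMap.rotation θ p).1).comp_hasDerivAt θ hc
    refine this.congr_deriv ?_
    simp [hG]
  have hFTC : ∫ θ in (0 : ℝ)..(Real.pi / 2), G θ = F p.2 - F p.1 := by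
    rw [intervalIntegral.integral_eq_sub_of_hasDerivAt (fun θ _ => hder θ)
      (hGc.intervalIntegrable _ _)]
    simp [ContinuousLinearMap.rotation_apply]
  -- Cauchy–Schwarz is obtained by expanding `∫ (G - m)² ≥ 0`, with `m` the mean of `G`.
  set m := (F p.2 - F p.1) / (Real.pi / 2) with hm
  have hnn : 0 ≤ ∫ θ in (0 : ℝ)..(Real.pi / 2), (G θ - m) ^ 2 :=
    intervalIntegral.integral_nonneg (by positivity) fun θ _ => sq_nonneg _
  have hexp : ∫ θ in (0 : ℝ)..(Real.pi / 2), (G θ - m) ^ 2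
      = (∫ θ in (0 : ℝ)..(Real.pi / 2), G θ ^ 2) - (2 * m) * (F p.2 - F p.1)
        + Real.pi / 2 * m ^ 2 := by
    have : ∀ θ, (G θ - m) ^ 2 = G θ ^ 2 - (2 * m) * G θ + m ^ 2 := fun θ => by ring
    simp_rw [this]
    rw [intervalIntegral.integral_add (Continuous.intervalIntegrable (by fun_prop) _ _)
      (Continuous.intervalIntegrable (by fun_prop) _ _),
      intervalIntegral.integral_sub (Continuous.intervalIntegrable (by fun_prop) _ _)
      (Continuous.intervalIntegrable (by fun_prop) _ _), intervalIntegral.integral_const_mul,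
      hFTC]
    simp
  have hd : F p.2 - F p.1 = m * (Real.pi / 2) := by rw [hm]; field_simp
  rw [hexp, hd] at hnn
  rw [hd]
  
  nlinarith

/-- A Poincaré inequality for the Gaussian measure, by integration along rotations. -/
theorem gaussianPi_poincare (s : Finset κ) {e : κ → ι} (he : Set.InjOn e s) {F : (ι → ℝ) → ℝ}
    {u : κ → (ι → ℝ) → ℝ}
    (hF : ∀ x, HasFDerivAt F
      (∑ l ∈ s, u l x • (ContinuousLinearMap.proj (R := ℝ) (φ := fun _ : ι => ℝ) (e l))) x)
    (hu : ∀ l ∈ s, Continuous (u l)) {M : ℝ} (huM : ∀ l ∈ s, ∀ x, |u l x| ≤ M)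
    (hFM : ∀ x, |F x| ≤ M) (h0 : ∫ x, F x ∂(gaussianPi ι v) = 0) :
    ∫ x, F x ^ 2 ∂(gaussianPi ι v)
      ≤ Real.pi ^ 2 / 8 * v * ∑ l ∈ s, ∫ x, u l x ^ 2 ∂(gaussianPi ι v) := by
  set γ := gaussianPi ι v
  have hπ := Real.pi_pos
  have hFc : Continuous F := continuous_iff_continuousAt.2 fun x => (hF x).continuousAt
  have hF2 : MemLp F 2 γ := MemLp.of_bound hFc.aestronglyMeasurable M
    (Filter.Eventually.of_forall fun x => by simpa using hFM x)
  set Φ : (ι → ℝ) × (ι → ℝ) → ℝ := fun p => (∑ l ∈ s, u l p.1 * p.2 (e l)) ^ 2 with hΦ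
  have hΦc : Continuous Φ := by
    refine (continuous_finsetSum _ fun l hl => ?_).pow 2
    exact ((hu l hl).comp continuous_fst).mul ((continuous_apply (e l)).comp continuous_snd)
  have hrot : Continuous fun q : ((ι → ℝ) × (ι → ℝ)) × ℝ => ContinuousLinearMap.rotation q.2 q.1 := by
    simp only [ContinuousLinearMap.rotation_apply]
    fun_prop
  have hpath : ∀ p : (ι → ℝ) × (ι → ℝ), (F p.2 - F p.1) ^ 2
      ≤ Real.pi / 2 * ∫ θ in (0 : ℝ)..(Real.pi / 2), Φ (ContinuousLinearMap.rotation θ p) :=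
    sq_sub_le_integral_rotation s hF hu
  have hM0 : 0 ≤ M := (abs_nonneg _).trans (hFM 0)
  have habs : ∀ l : κ, MemLp (fun q : ((ι → ℝ) × (ι → ℝ)) × ℝ => |q.1.1 (e l)| + |q.1.2 (e l)|) 2
      ((γ.prod γ).prod (volume.restrict (Set.Ioc 0 (Real.pi / 2)))) := by
    intro l
    have h1 := ((memLp_eval_gaussianPi v (e l)).comp_fst γ).comp_fst
      (volume.restrict (Set.Ioc 0 (Real.pi / 2)))
    have h2 := ((memLp_eval_gaussianPi v (e l)).comp_snd γ).comp_fst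
      (volume.restrict (Set.Ioc 0 (Real.pi / 2)))
    exact h1.abs.add h2.abs
  -- A square-integrable majorant independent of `θ`, from `|sin|, |cos| ≤ 1`. The bound `M` serves
  -- integrability only and does not enter the final constant.
  have hdom : MemLp (fun q : ((ι → ℝ) × (ι → ℝ)) × ℝ =>
      ∑ l ∈ s, M * (|q.1.1 (e l)| + |q.1.2 (e l)|)) 2
      ((γ.prod γ).prod (volume.restrict (Set.Ioc 0 (Real.pi / 2)))) :=
    memLp_finsetSum _ fun l _ => (habs l).const_mul M
  have hint : Integrable (fun q : ((ι → ℝ) × (ι → ℝ)) × ℝ =>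
      Φ (ContinuousLinearMap.rotation q.2 q.1))
      ((γ.prod γ).prod (volume.restrict (Set.Ioc 0 (Real.pi / 2)))) := by
    refine hdom.integrable_sq.mono' (hΦc.comp hrot).aestronglyMeasurable
      (Filter.Eventually.of_forall fun q => ?_)
    rw [Real.norm_eq_abs, hΦ, abs_pow]
    refine pow_le_pow_left₀ (abs_nonneg _) ((Finset.abs_sum_le_sum_abs _ _).trans
      (Finset.sum_le_sum fun l hl => ?_)) 2
    rw [abs_mul]
    refine mul_le_mul (huM l hl _) ?_ (abs_nonneg _) hM0
    simp only [ContinuousLinearMap.rotation_apply, Pi.add_apply, Pi.smul_apply, smul_eq_mul]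
    refine (abs_add_le _ _).trans (add_le_add ?_ ?_)
    · rw [abs_mul, abs_neg]
      exact mul_le_of_le_one_left (abs_nonneg _) (Real.abs_sin_le_one _)
    · rw [abs_mul]
      exact mul_le_of_le_one_left (abs_nonneg _) (Real.abs_cos_le_one _)
  have hintΦ : Integrable Φ (γ.prod γ) := by
    have hdom' : MemLp (fun p : (ι → ℝ) × (ι → ℝ) => ∑ l ∈ s, M * |p.2 (e l)|) 2 (γ.prod γ) :=
      memLp_finsetSum _ fun l _ => (((memLp_eval_gaussianPi v (e l)).comp_snd γ).abs).const_mul M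
    refine hdom'.integrable_sq.mono' hΦc.aestronglyMeasurable
      (Filter.Eventually.of_forall fun p => ?_)
    rw [Real.norm_eq_abs, hΦ, abs_pow]
    refine pow_le_pow_left₀ (abs_nonneg _) ((Finset.abs_sum_le_sum_abs _ _).trans
      (Finset.sum_le_sum fun l hl => ?_)) 2
    rw [abs_mul]
    exact mul_le_mul_of_nonneg_right (huM l hl _) (abs_nonneg _)
  have hΦint : ∫ p, Φ p ∂(γ.prod γ) = v * ∑ l ∈ s, ∫ x, u l x ^ 2 ∂γ := by
    rw [integral_prod _ hintΦ]
    simp only [hΦ]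
    simp_rw [γ, integral_sum_sq_gaussianPi v s he]
    rw [integral_const_mul, integral_finsetSum]
    intro l hl
    refine Integrable.of_bound ((hu l hl).pow 2).aestronglyMeasurable (M ^ 2)
      (Filter.Eventually.of_forall fun x => ?_)
    rw [Real.norm_eq_abs, abs_pow]
    exact pow_le_pow_left₀ (abs_nonneg _) (huM l hl x) 2
  -- Rotation invariance removes the dependence on `θ`, so the outer integral merely contributes
  -- another `π/2`.
  have hrotint : ∀ θ : ℝ, ∫ p, Φ (ContinuousLinearMap.rotation θ p) ∂(γ.prod γ)
      = ∫ p, Φ p ∂(γ.prod γ) := by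
    intro θ
    rw [← integral_map (φ := ContinuousLinearMap.rotation θ)
      (ContinuousLinearMap.continuous _).aemeasurable hΦc.aestronglyMeasurable,
      map_rotation_gaussianPi]
  have hFint : Integrable F γ := hF2.integrable (by norm_num)
  have hl1 : Integrable (fun p : (ι → ℝ) × (ι → ℝ) => F p.2 ^ 2) (γ.prod γ) :=
    (hF2.comp_snd γ).integrable_sq
  have hl2 : Integrable (fun p : (ι → ℝ) × (ι → ℝ) => 2 * (F p.1 * F p.2)) (γ.prod γ) :=
    (hFint.mul_prod hFint).const_mul 2
  have hl3 : Integrable (fun p : (ι → ℝ) × (ι → ℝ) => F p.1 ^ 2) (γ.prod γ) :=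
    (hF2.comp_fst γ).integrable_sq
  have hexpand : (fun p : (ι → ℝ) × (ι → ℝ) => (F p.2 - F p.1) ^ 2)
      = fun p => F p.2 ^ 2 - 2 * (F p.1 * F p.2) + F p.1 ^ 2 := by
    ext p; ring
  have hl12 : Integrable (fun p : (ι → ℝ) × (ι → ℝ) => F p.2 ^ 2 - 2 * (F p.1 * F p.2))
      (γ.prod γ) := hl1.sub hl2
  -- Centering kills the cross term; the resulting factor 2 turns `(π/2)²` into `π²/8`.
  have hlhs : ∫ p : (ι → ℝ) × (ι → ℝ), (F p.2 - F p.1) ^ 2 ∂(γ.prod γ) = 2 * ∫ x, F x ^ 2 ∂γ := by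
    rw [hexpand, integral_add hl12 hl3, integral_sub hl1 hl2, integral_const_mul,
      integral_prod_mul, h0, integral_fun_snd (fun x => F x ^ 2), integral_fun_fst (fun x => F x ^ 2)]
    simp
    ring
  have hmain : ∫ p : (ι → ℝ) × (ι → ℝ), (F p.2 - F p.1) ^ 2 ∂(γ.prod γ)
      ≤ ∫ p, (Real.pi / 2 * ∫ θ in (0 : ℝ)..(Real.pi / 2),
          Φ (ContinuousLinearMap.rotation θ p)) ∂(γ.prod γ) := by
    refine integral_mono ?_ ?_ hpath
    · rw [hexpand]
      exact (hl1.sub hl2).add hl3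
    · simp_rw [intervalIntegral.integral_of_le (show (0 : ℝ) ≤ Real.pi / 2 by positivity)]
      exact hint.integral_prod_left.const_mul _
  rw [hlhs, integral_const_mul] at hmain
  simp_rw [intervalIntegral.integral_of_le (show (0 : ℝ) ≤ Real.pi / 2 by positivity)] at hmain
  rw [integral_integral_swap hint] at hmain
  simp_rw [hrotint, hΦint] at hmain
  simp only [integral_const, measureReal_restrict_apply_univ, Real.volume_real_Ioc, smul_eq_mul,
    sub_zero, max_eq_left (show (0 : ℝ) ≤ Real.pi / 2 by positivity)] at hmain
  nlinarith

end Gaussian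


lemma Spin.val_one : Spin.val 1 = 1 := by simp [Spin.val]

lemma Spin.val_neg_one : Spin.val (-1) = -1 := by simp [Spin.val]

lemma Spin.val_mul_self (s : Spin) : s.val * s.val = 1 := by
  rcases Int.units_eq_one_or s with rfl | rfl <;> simp [Spin.val]

lemma Spin.abs_val (s : Spin) : |s.val| = 1 := by
  rcases Int.units_eq_one_or s with rfl | rfl <;> simp [Spin.val]

/-! ### Spin systems on a finite set: Gibbs averages and cumulants -/

section Model

variable {V : Type*} [Fintype V] [LinearOrder V]

/-- The energy of a spin system in which only the spins in `B` interact, with couplings indexed by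
unordered pairs and a deterministic external field. -/
def energy (B : Finset V) (J : Sym2 V → ℝ) (x : V → ℝ) (σ : V → Spin) : ℝ :=
  (∑ a ∈ B, ∑ b ∈ B, if a < b then J s(a, b) * (σ a).val * (σ b).val else 0)
    + ∑ a ∈ B, x a * (σ a).val

/-- The Gibbs average with respect to `energy`. -/
def ev (B : Finset V) (J : Sym2 V → ℝ) (x : V → ℝ) (f : (V → Spin) → ℝ) : ℝ :=
  (∑ σ, f σ * Real.exp (energy B J x σ)) / ∑ σ, Real.exp (energy B J x σ)

def mag (B : Finset V) (J : Sym2 V → ℝ) (x : V → ℝ) (j : V) : ℝ :=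
  ev B J x fun σ => (σ j).val

def cov (B : Finset V) (J : Sym2 V → ℝ) (x : V → ℝ) (j k : V) : ℝ :=
  ev B J x (fun σ => (σ j).val * (σ k).val) - mag B J x j * mag B J x k

/-- The third joint cumulant of three spins. -/
def cum3 (B : Finset V) (J : Sym2 V → ℝ) (x : V → ℝ) (j k l : V) : ℝ :=
  ev B J x (fun σ => (σ j).val * (σ k).val * (σ l).val)
    - mag B J x j * ev B J x (fun σ => (σ k).val * (σ l).val)
    - mag B J x k * ev B J x (fun σ => (σ j).val * (σ l).val)
    - mag B J x l * ev B J x (fun σ => (σ j).val * (σ k).val)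
    + 2 * mag B J x j * mag B J x k * mag B J x l

variable (B C : Finset V) (J : Sym2 V → ℝ) (x : V → ℝ)

lemma partition_pos : 0 < ∑ σ, Real.exp (energy B J x σ) :=
  Finset.sum_pos (fun _ _ => Real.exp_pos _) Finset.univ_nonempty

lemma abs_ev_le {f : (V → Spin) → ℝ} {c : ℝ} (hf : ∀ σ, |f σ| ≤ c) : |ev B J x f| ≤ c := by
  have hZ := partition_pos B J x
  rw [ev, abs_div, abs_of_pos hZ, div_le_iff₀ hZ, Finset.mul_sum]
  refine (Finset.abs_sum_le_sum_abs _ _).trans (Finset.sum_le_sum fun σ _ => ?_)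
  rw [abs_mul, Real.abs_exp]
  exact mul_le_mul_of_nonneg_right (hf σ) (Real.exp_pos _).le

lemma ev_one : ev B J x (fun _ => 1) = 1 := by
  simp [ev, div_self (partition_pos B J x).ne']

lemma abs_mag_le (j : V) : |mag B J x j| ≤ 1 :=
  abs_ev_le B J x fun _ => (Spin.abs_val _).le

lemma abs_ev_mul_le (j k : V) : |ev B J x fun σ => (σ j).val * (σ k).val| ≤ 1 :=
  abs_ev_le B J x fun σ => by simp [abs_mul, Spin.abs_val]

lemma abs_cov_le (j k : V) : |cov B J x j k| ≤ 2 := by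
  refine (abs_sub _ _).trans ?_
  have h1 := abs_ev_mul_le B J x j k
  have h2 : |mag B J x j * mag B J x k| ≤ 1 := by
    rw [abs_mul]
    exact mul_le_one₀ (abs_mag_le B J x j) (abs_nonneg _) (abs_mag_le B J x k)
  linarith

lemma cov_comm (j k : V) : cov B J x j k = cov B J x k j := by
  simp only [cov, mul_comm]

lemma cov_self (j : V) : cov B J x j j = 1 - mag B J x j ^ 2 := by
  simp only [cov, Spin.val_mul_self, ev_one]
  ring

lemma abs_cov_self_le (j : V) : |cov B J x j j| ≤ 1 := by
  have := (sq_le_one_iff_abs_le_one _).2 (abs_mag_le B J x j)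
  rw [cov_self, abs_le]
  constructor <;> nlinarith [sq_nonneg (mag B J x j)]

lemma cum3_swap (j k l : V) : cum3 B J x j k l = cum3 B J x k j l := by
  have h1 : (fun σ : V → Spin => (σ j).val * (σ k).val * (σ l).val)
      = fun σ => (σ k).val * (σ j).val * (σ l).val := funext fun σ => by ring
  have h2 : (fun σ : V → Spin => (σ j).val * (σ k).val)
      = fun σ => (σ k).val * (σ j).val := funext fun σ => mul_comm _ _
  rw [cum3, cum3, h1, h2]
  ring

/-- Since `σ_j² = 1`, a repeated index lowers the order: these degenerate gradient terms are
controlled by covariances. -/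
lemma cum3_left (j k : V) : cum3 B J x j k j = -2 * mag B J x j * cov B J x j k := by
  have h : ∀ σ : V → Spin, (σ j).val * (σ k).val * (σ j).val = (σ k).val := fun σ => by
    rw [mul_right_comm, Spin.val_mul_self, one_mul]
  simp only [cum3, cov, h, Spin.val_mul_self, ev_one]
  rw [show (fun σ : V → Spin => (σ k).val * (σ j).val) = fun σ => (σ j).val * (σ k).val from
    funext fun σ => mul_comm _ _]
  simp only [mag]
  ring

lemma abs_cum3_le (j k l : V) : |cum3 B J x j k l| ≤ 6 := by
  have h1 : |ev B J x fun σ => (σ j).val * (σ k).val * (σ l).val| ≤ 1 :=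
    abs_ev_le B J x fun σ => by simp [abs_mul, Spin.abs_val]
  have hm := abs_mag_le B J x
  have h2 : ∀ a b c : V, |mag B J x a * ev B J x fun σ => (σ b).val * (σ c).val| ≤ 1 := by
    intro a b c
    rw [abs_mul]
    exact mul_le_one₀ (hm a) (abs_nonneg _) (abs_ev_mul_le B J x b c)
  have h3 : |2 * mag B J x j * mag B J x k * mag B J x l| ≤ 2 := by
    simp only [abs_mul, abs_two]
    have := mul_le_one₀ (mul_le_one₀ (hm j) (abs_nonneg _) (hm k)) (abs_nonneg _) (hm l)
    nlinarith
  have := abs_le.1 h1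
  have := abs_le.1 (h2 j k l)
  have := abs_le.1 (h2 k j l)
  have := abs_le.1 (h2 l j k)
  have := abs_le.1 h3
  rw [cum3, abs_le]
  constructor <;> linarith

lemma continuous_ev (f : (V → Spin) → ℝ) :
    Continuous fun q : (Sym2 V → ℝ) × (V → ℝ) => ev B q.1 q.2 f := by
  have h : ∀ σ, Continuous fun q : (Sym2 V → ℝ) × (V → ℝ) => Real.exp (energy B q.1 q.2 σ) := by
    intro σ
    refine Real.continuous_exp.comp (Continuous.add ?_ (by fun_prop))
    refine continuous_finsetSum _ fun a _ => continuous_finsetSum _ fun b _ => ?_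
    split_ifs <;> fun_prop
  exact (continuous_finsetSum _ fun σ _ => continuous_const.mul (h σ)).div
    (continuous_finsetSum _ fun σ _ => h σ) fun q => (partition_pos B q.1 q.2).ne'

lemma continuous_mag (j : V) : Continuous fun q : (Sym2 V → ℝ) × (V → ℝ) => mag B q.1 q.2 j :=
  continuous_ev B _

lemma continuous_cov (j k : V) :
    Continuous fun q : (Sym2 V → ℝ) × (V → ℝ) => cov B q.1 q.2 j k :=
  (continuous_ev B _).sub ((continuous_mag B j).mul (continuous_mag B k))

lemma continuous_cum3 (j k l : V) :
    Continuous fun q : (Sym2 V → ℝ) × (V → ℝ) => cum3 B q.1 q.2 j k l := by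
  have h1 := continuous_ev B (fun σ => (σ j).val * (σ k).val * (σ l).val)
  have h2 := fun a b => continuous_ev B (fun σ : V → Spin => (σ a).val * (σ b).val)
  have hm := continuous_mag B
  exact ((((h1.sub ((hm j).mul (h2 k l))).sub ((hm k).mul (h2 j l))).sub
    ((hm l).mul (h2 j k))).add (((continuous_const.mul (hm j)).mul (hm k)).mul (hm l)))

/-! ### Conditioning on one spin -/

section Conditioning

lemma sum_eq_half_sum_update (i : V) (g : (V → Spin) → ℝ) :
    ∑ σ, g σ = 2⁻¹ * ∑ σ, (g (Function.update σ i 1) + g (Function.update σ i (-1))) := by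
  have hinv : Function.Involutive fun σ : V → Spin => Function.update σ i (-σ i) := by
    intro σ
    simp
  have hs : ∑ σ, g (Function.update σ i (-σ i)) = ∑ σ, g σ :=
    Equiv.sum_comp hinv.toPerm g
  have : ∀ σ : V → Spin, g (Function.update σ i 1) + g (Function.update σ i (-1))
      = g σ + g (Function.update σ i (-σ i)) := by
    intro σ
    rcases Int.units_eq_one_or (σ i) with h | h
    · have : Function.update σ i 1 = σ := by rw [← h, Function.update_eq_self]
      rw [this, h]
    · have : Function.update σ i (-1) = σ := by rw [← h, Function.update_eq_self]
      rw [this, h, neg_neg, add_comm]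
  simp_rw [this, Finset.sum_add_distrib, hs]
  ring

/-- The external field seen by the other spins when the spin `i` is set to `s`. -/
def shift (i : V) (c : ℝ) (y : Sym2 V → ℝ) (x : V → ℝ) : V → ℝ := fun l => x l + c * y s(i, l)

variable {i : V} {C}

lemma energy_insert (hi : i ∉ C) (s : Spin) (σ : V → Spin) :
    energy (insert i C) J x (Function.update σ i s)
      = energy C J (shift i s.val J x) σ + x i * s.val := by
  have hne : ∀ a ∈ C, a ≠ i := fun a ha h => hi (h ▸ ha)
  have hup : ∀ a ∈ C, Function.update σ i s a = σ a := fun a ha =>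
    Function.update_of_ne (hne a ha) _ _
  have h1 : ∀ a ∈ C, (∑ b ∈ insert i C, if a < b then
        J s(a, b) * (Function.update σ i s a).val * (Function.update σ i s b).val else 0)
      = (if a < i then J s(i, a) * s.val * (σ a).val else 0)
        + ∑ b ∈ C, if a < b then J s(a, b) * (σ a).val * (σ b).val else 0 := by
    intro a ha
    rw [Finset.sum_insert hi, hup a ha, Function.update_self, Sym2.eq_swap]
    congr 1
    · split_ifs <;> ring
    · refine Finset.sum_congr rfl fun b hb => ?_
      rw [hup b hb]
  have h2 : (∑ b ∈ insert i C, if i < b then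
        J s(i, b) * (Function.update σ i s i).val * (Function.update σ i s b).val else 0)
      = ∑ b ∈ C, if i < b then J s(i, b) * s.val * (σ b).val else 0 := by
    rw [Finset.sum_insert hi, if_neg (lt_irrefl i), zero_add]
    refine Finset.sum_congr rfl fun b hb => ?_
    rw [hup b hb, Function.update_self]
  have h3 : ∀ a ∈ C, x a * (Function.update σ i s a).val = x a * (σ a).val := fun a ha => by
    rw [hup a ha]
  have h4 : ∀ a ∈ C, (if i < a then J s(i, a) * s.val * (σ a).val else 0)
      + (if a < i then J s(i, a) * s.val * (σ a).val else 0) = s.val * J s(i, a) * (σ a).val := by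
    intro a ha
    rcases lt_or_gt_of_ne (hne a ha) with h | h
    · rw [if_neg h.not_gt, if_pos h]; ring
    · rw [if_pos h, if_neg h.not_gt]; ring
  simp only [energy, shift]
  rw [Finset.sum_insert hi, h2, Finset.sum_congr rfl h1, Finset.sum_insert hi,
    Function.update_self, Finset.sum_congr rfl h3, Finset.sum_add_distrib]
  simp only [add_mul, Finset.sum_add_distrib]
  rw [← Finset.sum_congr rfl h4, Finset.sum_add_distrib]
  ring

/-- Total expectation over the value of spin `i`: `p` and `q` are the Gibbs probabilities of the two
values, hence the same for every observable. Configurations keep all of `V`, so the spin removed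
from the interaction becomes a free coordinate, and no change of index type is needed. -/
lemma exists_ev_insert (hi : i ∉ C) : ∃ p q : ℝ, 0 ≤ p ∧ 0 ≤ q ∧ p + q = 1 ∧
    ∀ f : (V → Spin) → ℝ, ev (insert i C) J x f
      = p * ev C J (shift i 1 J x) (fun σ => f (Function.update σ i 1))
        + q * ev C J (shift i (-1) J x) (fun σ => f (Function.update σ i (-1))) := by
  set Zp := ∑ σ, Real.exp (energy C J (shift i 1 J x) σ) with hZp
  set Zq := ∑ σ, Real.exp (energy C J (shift i (-1) J x) σ) with hZq
  have hp : 0 < Zp := partition_pos _ _ _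
  have hq : 0 < Zq := partition_pos _ _ _
  have key : ∀ f : (V → Spin) → ℝ, ∑ σ, f σ * Real.exp (energy (insert i C) J x σ)
      = 2⁻¹ * (Real.exp (x i) * ∑ σ, f (Function.update σ i 1)
            * Real.exp (energy C J (shift i 1 J x) σ)
        + Real.exp (-x i) * ∑ σ, f (Function.update σ i (-1))
            * Real.exp (energy C J (shift i (-1) J x) σ)) := by
    intro f
    rw [sum_eq_half_sum_update i, Finset.sum_add_distrib, Finset.mul_sum, Finset.mul_sum]
    congr 2
    · refine Finset.sum_congr rfl fun σ _ => ?_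
      rw [energy_insert J x hi, Spin.val_one, mul_one, Real.exp_add]
      ring
    · refine Finset.sum_congr rfl fun σ _ => ?_
      rw [energy_insert J x hi, Spin.val_neg_one, mul_neg_one, Real.exp_add]
      ring
  have hZ : ∑ σ, Real.exp (energy (insert i C) J x σ)
      = 2⁻¹ * (Real.exp (x i) * Zp + Real.exp (-x i) * Zq) := by
    simpa using key fun _ => 1
  have he := Real.exp_pos (x i)
  have he' := Real.exp_pos (-x i)
  have hsum : 0 < Real.exp (x i) * Zp + Real.exp (-x i) * Zq := by positivity
  refine ⟨Real.exp (x i) * Zp / (Real.exp (x i) * Zp + Real.exp (-x i) * Zq),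
    Real.exp (-x i) * Zq / (Real.exp (x i) * Zp + Real.exp (-x i) * Zq), by positivity,
    by positivity, by rw [← add_div, div_self hsum.ne'], fun f => ?_⟩
  rw [ev, key, hZ, ev, ev, ← hZp, ← hZq]
  field_simp

/-- Half the difference of an observable between the two values of the conditioned spin. -/
def magDiff (C : Finset V) (J : Sym2 V → ℝ) (x : V → ℝ) (i : V) (y : Sym2 V → ℝ) (j : V) : ℝ :=
  2⁻¹ * (mag C J (shift i 1 y x) j - mag C J (shift i (-1) y x) j)

def covDiff (C : Finset V) (J : Sym2 V → ℝ) (x : V → ℝ) (i : V) (y : Sym2 V → ℝ) (j k : V) : ℝ :=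
  2⁻¹ * (cov C J (shift i 1 y x) j k - cov C J (shift i (-1) y x) j k)

lemma abs_magDiff_le (C : Finset V) (J : Sym2 V → ℝ) (x : V → ℝ) (i : V) (y : Sym2 V → ℝ) (j : V) :
    |magDiff C J x i y j| ≤ 1 := by
  have h1 := abs_le.1 (abs_mag_le C J (shift i 1 y x) j)
  have h2 := abs_le.1 (abs_mag_le C J (shift i (-1) y x) j)
  rw [magDiff, abs_le]
  constructor <;> linarith

lemma abs_covDiff_le (C : Finset V) (J : Sym2 V → ℝ) (x : V → ℝ) (i : V) (y : Sym2 V → ℝ)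
    (j k : V) : |covDiff C J x i y j k| ≤ 2 := by
  have h1 := abs_le.1 (abs_cov_le C J (shift i 1 y x) j k)
  have h2 := abs_le.1 (abs_cov_le C J (shift i (-1) y x) j k)
  rw [covDiff, abs_le]
  constructor <;> linarith

/-- For a mixture with weights `p`, `q` the covariance with the mixing spin is exactly `4pq ·
magDiff`, and `4pq ≤ 1`. -/
lemma abs_cov_insert_le (hi : i ∉ C) {j : V} (hj : j ≠ i) :
    |cov (insert i C) J x i j| ≤ |magDiff C J x i J j| := by
  obtain ⟨p, q, hp, hq, hpq, h⟩ := exists_ev_insert J x hi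
  have e1 := fun (c : ℝ) => ev_one C J (shift i c J x)
  have hc : cov (insert i C) J x i j = 4 * p * q * magDiff C J x i J j := by
    simp only [cov, mag, h, Function.update_self, Function.update_of_ne hj, Spin.val_one,
      Spin.val_neg_one, one_mul, magDiff]
    have hn : ∀ (c : ℝ) (f : (V → Spin) → ℝ), ev C J (shift i c J x) (fun σ => -1 * f σ)
        = - ev C J (shift i c J x) f := fun c f => by
      simp [ev, neg_div]
    have hn1 : ev C J (shift i (-1) J x) (fun _ => -1) = -1 := by
      simpa [e1] using hn (-1) fun _ => 1
    rw [hn, hn1, e1]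
    obtain rfl : q = 1 - p := by linarith
    ring
  rw [hc, abs_mul]
  refine mul_le_of_le_one_left (abs_nonneg _) ?_
  rw [abs_of_nonneg (by positivity)]
  obtain rfl : q = 1 - p := by linarith
  nlinarith [sq_nonneg (2 * p - 1)]

/-- Expanding the mixture gives `4pq · covDiff - 8pq(p - q) · magDiff_j · magDiff_k`; then `4pq ≤ 1`
and `|p - q| ≤ 1`. -/
lemma abs_cum3_insert_le (hi : i ∉ C) {j k : V} (hj : j ≠ i) (hk : k ≠ i) :
    |cum3 (insert i C) J x i j k|
      ≤ |covDiff C J x i J j k| + 2 * |magDiff C J x i J j * magDiff C J x i J k| := by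
  obtain ⟨p, q, hp, hq, hpq, h⟩ := exists_ev_insert J x hi
  have e1 := fun (c : ℝ) => ev_one C J (shift i c J x)
  have hc : cum3 (insert i C) J x i j k = 4 * p * q * covDiff C J x i J j k
      - 4 * p * q * (p - q) * (2 * (magDiff C J x i J j * magDiff C J x i J k)) := by
    simp only [cum3, cov, mag, h, Function.update_self, Function.update_of_ne hj,
      Function.update_of_ne hk, Spin.val_one,
      Spin.val_neg_one, one_mul, magDiff, covDiff, mul_assoc (-1 : ℝ)]
    have hn : ∀ (c : ℝ) (f : (V → Spin) → ℝ), ev C J (shift i c J x) (fun σ => -1 * f σ)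
        = - ev C J (shift i c J x) f := fun c f => by
      simp [ev, neg_div]
    have hn1 : ev C J (shift i (-1) J x) (fun _ => -1) = -1 := by
      simpa [e1] using hn (-1) fun _ => 1
    rw [hn, hn, hn, hn1, e1]
    obtain rfl : q = 1 - p := by linarith
    ring
  have hpq4 : |4 * p * q| ≤ 1 := by
    rw [abs_of_nonneg (by positivity)]
    obtain rfl : q = 1 - p := by linarith
    nlinarith [sq_nonneg (2 * p - 1)]
  have hpq1 : |4 * p * q * (p - q)| ≤ 1 := by
    rw [abs_mul]
    refine mul_le_one₀ hpq4 (abs_nonneg _) ?_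
    rw [abs_le]
    constructor <;> linarith
  rw [hc]
  refine (abs_sub _ _).trans (add_le_add ?_ ?_)
  · rw [abs_mul]
    exact mul_le_of_le_one_left (abs_nonneg _) hpq4
  · rw [abs_mul _ (2 * _), abs_mul 2, abs_two]
    exact mul_le_of_le_one_left (by positivity) hpq1

end Conditioning

/-! ### Derivatives in the couplings of the conditioned spin -/

section Derivative

/-- The coordinate functional of the coupling between `i` and `l`. -/
abbrev coord (i l : V) : (Sym2 V → ℝ) →L[ℝ] ℝ :=
  ContinuousLinearMap.proj (R := ℝ) (φ := fun _ : Sym2 V => ℝ) s(i, l)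

/-- Only the field depends on `y`, through `c * y s(i, l)` at site `l`. The derivative of a Gibbs
average in the field at `l` is its covariance with `σ_l`. -/
lemma hasFDerivAt_ev (i : V) (c : ℝ) (f : (V → Spin) → ℝ) (y : Sym2 V → ℝ) :
    HasFDerivAt (fun y => ev C J (shift i c y x) f)
      (∑ l ∈ C, (c * (ev C J (shift i c y x) (fun σ => f σ * (σ l).val)
        - ev C J (shift i c y x) f * mag C J (shift i c y x) l)) • coord i l) y := by
  have hE : ∀ σ, HasFDerivAt (fun y => energy C J (shift i c y x) σ)
      (∑ l ∈ C, (c * (σ l).val) • coord i l) y := by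
    intro σ
    have hl : ∀ l ∈ C, HasFDerivAt (fun y : Sym2 V → ℝ => (x l + c * y s(i, l)) * (σ l).val)
        ((c * (σ l).val) • coord i l) y := by
      intro l _
      have h1 := ((((coord i l).hasFDerivAt (x := y)).const_mul c).const_add (x l)).mul_const
        (σ l).val
      refine h1.congr_fderiv ?_
      rw [smul_smul, mul_comm]
    exact (HasFDerivAt.fun_sum hl).const_add _
  have hexp := fun σ => (hE σ).exp
  have hnum : HasFDerivAt (fun y => ∑ σ, f σ * Real.exp (energy C J (shift i c y x) σ)) _ y :=
    HasFDerivAt.fun_sum fun σ _ => (hexp σ).const_mul (f σ)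
  have hden : HasFDerivAt (fun y => ∑ σ, Real.exp (energy C J (shift i c y x) σ)) _ y :=
    HasFDerivAt.fun_sum fun σ _ => hexp σ
  have hZ := (partition_pos C J (shift i c y x)).ne'
  have hinv := (hasDerivAt_inv hZ).comp_hasFDerivAt y hden
  refine (hnum.mul hinv).congr_fderiv ?_
  ext z
  have hswap : ∀ g : (V → Spin) → ℝ, ∑ σ, g σ * (Real.exp (energy C J (shift i c y x) σ)
        * ∑ l ∈ C, c * (σ l).val * z s(i, l))
      = ∑ l ∈ C, c * z s(i, l)
        * ∑ σ, g σ * (σ l).val * Real.exp (energy C J (shift i c y x) σ) := by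
    intro g
    simp_rw [Finset.mul_sum]
    rw [Finset.sum_comm]
    exact Finset.sum_congr rfl fun l _ => Finset.sum_congr rfl fun σ _ => by ring
  have h1 := hswap f
  have h2 := hswap fun _ => 1
  simp only [one_mul] at h2
  simp only [add_apply, smul_apply, sum_apply, ContinuousLinearMap.proj_apply, smul_eq_mul,
    Function.comp_apply]
  rw [h1, h2, Finset.mul_sum, Finset.mul_sum, Finset.mul_sum, ← Finset.sum_add_distrib]
  refine Finset.sum_congr rfl fun l _ => ?_
  simp only [ev, mag]
  field_simp
  ring

lemma hasFDerivAt_mag (i : V) (c : ℝ) (j : V) (y : Sym2 V → ℝ) :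
    HasFDerivAt (fun y => mag C J (shift i c y x) j)
      (∑ l ∈ C, (c * cov C J (shift i c y x) j l) • coord i l) y :=
  hasFDerivAt_ev C J x i c _ y

lemma hasFDerivAt_cov (i : V) (c : ℝ) (j k : V) (y : Sym2 V → ℝ) :
    HasFDerivAt (fun y => cov C J (shift i c y x) j k)
      (∑ l ∈ C, (c * cum3 C J (shift i c y x) j k l) • coord i l) y := by
  refine ((hasFDerivAt_ev C J x i c (fun σ => (σ j).val * (σ k).val) y).sub
    ((hasFDerivAt_mag C J x i c j y).mul (hasFDerivAt_mag C J x i c k y))).congr_fderiv ?_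
  rw [Finset.smul_sum, Finset.smul_sum, ← Finset.sum_add_distrib, ← Finset.sum_sub_distrib]
  refine Finset.sum_congr rfl fun l _ => ?_
  simp only [smul_smul, ← add_smul, ← sub_smul]
  congr 1
  simp only [cum3, cov]
  ring

/-- The chain-rule signs ±1 cancel the minus sign of the half-difference, so the gradient is an
average of covariances over the two conditioned systems. -/
lemma hasFDerivAt_magDiff (i j : V) (y : Sym2 V → ℝ) :
    HasFDerivAt (fun y => magDiff C J x i y j)
      (∑ l ∈ C, (2⁻¹ * (cov C J (shift i 1 y x) j l + cov C J (shift i (-1) y x) j l))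
        • coord i l) y := by
  refine (((hasFDerivAt_mag C J x i 1 j y).sub (hasFDerivAt_mag C J x i (-1) j y)).const_mul
    2⁻¹).congr_fderiv ?_
  rw [← Finset.sum_sub_distrib, Finset.smul_sum]
  refine Finset.sum_congr rfl fun l _ => ?_
  rw [← sub_smul, smul_smul]
  congr 1
  ring

lemma hasFDerivAt_covDiff (i j k : V) (y : Sym2 V → ℝ) :
    HasFDerivAt (fun y => covDiff C J x i y j k)
      (∑ l ∈ C, (2⁻¹ * (cum3 C J (shift i 1 y x) j k l + cum3 C J (shift i (-1) y x) j k l))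
        • coord i l) y := by
  refine (((hasFDerivAt_cov C J x i 1 j k y).sub (hasFDerivAt_cov C J x i (-1) j k y)).const_mul
    2⁻¹).congr_fderiv ?_
  rw [← Finset.sum_sub_distrib, Finset.smul_sum]
  refine Finset.sum_congr rfl fun l _ => ?_
  rw [← sub_smul, smul_smul]
  congr 1
  ring

end Derivative

end Model


/-! ### Odd functions and the conditional Poincaré inequality -/

section Symmetry

variable {ι : Type*} [Fintype ι] (v : ℝ≥0)

lemma map_neg_gaussianPi : (gaussianPi ι v).map (fun y => -y) = gaussianPi ι v := by
  have h : (gaussianReal 0 v).map (fun a : ℝ => -a) = gaussianReal 0 v := by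
    rw [gaussianReal_map_neg, neg_zero]
  have := Measure.pi_map_pi (μ := fun _ : ι => gaussianReal 0 v) (f := fun _ (a : ℝ) => -a)
    (hμ := fun _ => by rw [h]; infer_instance) fun _ => by fun_prop
  simp only [h] at this
  exact this

lemma integral_odd_gaussianPi {F : (ι → ℝ) → ℝ} (hFc : Continuous F) (hF : ∀ y, F (-y) = -F y) :
    ∫ y, F y ∂(gaussianPi ι v) = 0 := by
  have h := integral_map (μ := gaussianPi ι v) (φ := fun y => -y) (f := F)
    (by fun_prop) hFc.aestronglyMeasurable
  rw [map_neg_gaussianPi] at h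
  simp only [hF, integral_neg] at h
  linarith

lemma integrable_of_continuous_of_abs_le {α : Type*} [TopologicalSpace α] [MeasurableSpace α]
    [OpensMeasurableSpace α] [SecondCountableTopology α] {μ : Measure α} [IsFiniteMeasure μ]
    {f : α → ℝ} (hf : Continuous f) {M : ℝ} (hM : ∀ a, |f a| ≤ M) : Integrable f μ :=
  Integrable.of_bound hf.aestronglyMeasurable M (Filter.Eventually.of_forall fun a => by
    simpa using hM a)

/-- The Poincaré inequality in the second variable for a function odd in that variable. -/
theorem gaussianPi_prod_poincare {κ : Type*} (s : Finset κ) {e : κ → ι} (he : Set.InjOn e s)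
    {F : (ι → ℝ) → (ι → ℝ) → ℝ} {u : κ → (ι → ℝ) → (ι → ℝ) → ℝ}
    (hF : ∀ z y, HasFDerivAt (F z)
      (∑ l ∈ s, u l z y • (ContinuousLinearMap.proj (R := ℝ) (φ := fun _ : ι => ℝ) (e l))) y)
    (hFc : Continuous fun q : (ι → ℝ) × (ι → ℝ) => F q.1 q.2)
    (hu : ∀ l ∈ s, Continuous fun q : (ι → ℝ) × (ι → ℝ) => u l q.1 q.2) {M : ℝ}
    (huM : ∀ l ∈ s, ∀ z y, |u l z y| ≤ M) (hFM : ∀ z y, |F z y| ≤ M)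
    (hodd : ∀ z y, F z (-y) = - F z y) :
    ∫ q, F q.1 q.2 ^ 2 ∂((gaussianPi ι v).prod (gaussianPi ι v))
      ≤ Real.pi ^ 2 / 8 * v
        * ∑ l ∈ s, ∫ q, u l q.1 q.2 ^ 2 ∂((gaussianPi ι v).prod (gaussianPi ι v)) := by
  have hFi : Integrable (fun q : (ι → ℝ) × (ι → ℝ) => F q.1 q.2 ^ 2)
      ((gaussianPi ι v).prod (gaussianPi ι v)) :=
    integrable_of_continuous_of_abs_le (hFc.pow 2) (M := M ^ 2) fun q => by
      rw [abs_pow]; exact pow_le_pow_left₀ (abs_nonneg _) (hFM _ _) 2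
  have hui : ∀ l ∈ s, Integrable (fun q : (ι → ℝ) × (ι → ℝ) => u l q.1 q.2 ^ 2)
      ((gaussianPi ι v).prod (gaussianPi ι v)) := fun l hl =>
    integrable_of_continuous_of_abs_le ((hu l hl).pow 2) (M := M ^ 2) fun q => by
      rw [abs_pow]; exact pow_le_pow_left₀ (abs_nonneg _) (huM l hl _ _) 2
  rw [integral_prod _ hFi, Finset.sum_congr rfl fun l hl => integral_prod _ (hui l hl),
    ← integral_finsetSum _ fun l hl => (hui l hl).integral_prod_left, ← integral_const_mul]
  refine integral_mono hFi.integral_prod_left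
    ((integrable_finsetSum _ fun l hl => (hui l hl).integral_prod_left).const_mul _) fun z => ?_
  -- For fixed `z`, oddness in the second variable supplies the centering.
  exact gaussianPi_poincare v s he (hF z)
    (fun l hl => (hu l hl).comp (continuous_const.prodMk continuous_id)) (huM · · z) (hFM z)
    (integral_odd_gaussianPi v (hFc.comp (continuous_const.prodMk continuous_id)) (hodd z))

end Symmetry

/-! ### Inequalities for real powers -/

section Power

/-- The signed power keeps an odd function odd, hence centered, whereas `|a|^(1+r)` would not. -/
lemma hasDerivAt_mul_abs_rpow {r : ℝ} (hr : 0 < r) (a : ℝ) :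
    HasDerivAt (fun a : ℝ => a * |a| ^ r) ((1 + r) * |a| ^ r) a := by
  rcases eq_or_ne a 0 with rfl | ha
  · rw [abs_zero, Real.zero_rpow hr.ne', mul_zero, hasDerivAt_iff_tendsto_slope_zero]
    have hc : Continuous fun a : ℝ => |a| ^ r :=
      continuous_abs.rpow_const fun _ => Or.inr hr.le
    have h0 : Filter.Tendsto (fun a : ℝ => |a| ^ r) (nhdsWithin 0 {0}ᶜ) (nhds 0) := by
      have := hc.tendsto 0
      rw [abs_zero, Real.zero_rpow hr.ne'] at this
      exact this.mono_left nhdsWithin_le_nhds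
    refine h0.congr' ?_
    filter_upwards [self_mem_nhdsWithin] with b hb
    have hb : b ≠ 0 := hb
    simp only [zero_add, smul_eq_mul, zero_mul, sub_zero]
    field_simp
  · have h := (hasDerivAt_id a).mul ((hasDerivAt_abs ha).rpow_const (p := r)
      (Or.inl (abs_ne_zero.2 ha)))
    refine h.congr_deriv ?_
    simp only [id]
    have h1 : a * (SignType.sign a : ℝ) = |a| := by
      rw [mul_comm]; exact sign_mul_self a
    rw [Real.rpow_sub_one (abs_ne_zero.2 ha)]
    have h2 := abs_ne_zero.2 ha
    field_simp
    linear_combination r * h1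

/-- Young's inequality with weights `1 - 2/p` and `2/p`; the first is small when `p` is near 2. -/
lemma abs_rpow_mul_sq_le {p : ℝ} (hp : 2 < p) (a b : ℝ) :
    |a| ^ (p - 2) * b ^ 2 ≤ (1 - 2 / p) * |a| ^ p + 2 / p * |b| ^ p := by
  have hp0 : 0 < p := by linarith
  have h2 : 2 / p ≤ 1 := by rw [div_le_one hp0]; exact hp.le
  have h := Real.geom_mean_le_arith_mean2_weighted (w₁ := 1 - 2 / p) (w₂ := 2 / p)
    (p₁ := |a| ^ p) (p₂ := |b| ^ p) (by linarith) (by positivity) (by positivity) (by positivity)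
    (by ring)
  rw [← Real.rpow_mul (abs_nonneg _), ← Real.rpow_mul (abs_nonneg _)] at h
  have e1 : p * (1 - 2 / p) = p - 2 := by field_simp
  have e2 : p * (2 / p) = ((2 : ℕ) : ℝ) := by field_simp; norm_num
  rwa [e1, e2, Real.rpow_natCast, sq_abs] at h

lemma abs_half_add_rpow_le {p : ℝ} (hp : 1 ≤ p) (a b : ℝ) :
    |2⁻¹ * (a + b)| ^ p ≤ 2⁻¹ * |a| ^ p + 2⁻¹ * |b| ^ p := by
  have h := (convexOn_rpow hp).2 (Set.mem_Ici.2 (abs_nonneg a)) (Set.mem_Ici.2 (abs_nonneg b))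
    (show (0 : ℝ) ≤ 2⁻¹ by norm_num) (show (0 : ℝ) ≤ 2⁻¹ by norm_num) (by norm_num)
  simp only [smul_eq_mul] at h
  refine le_trans (Real.rpow_le_rpow (abs_nonneg _) ?_ (by linarith)) h
  rw [abs_mul, abs_of_pos (show (0 : ℝ) < 2⁻¹ by norm_num), ← mul_add]
  exact mul_le_mul_of_nonneg_left (abs_add_le a b) (by norm_num)

end Power

/-! ### Independence of the couplings of the conditioned spin -/

section Resampling

variable {V : Type*} [Fintype V] [LinearOrder V]

lemma ev_congr {C : Finset V} {J J' : Sym2 V → ℝ} {x x' : V → ℝ}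
    (hJ : ∀ a ∈ C, ∀ b ∈ C, a < b → J s(a, b) = J' s(a, b)) (hx : ∀ a ∈ C, x a = x' a)
    (f : (V → Spin) → ℝ) : ev C J x f = ev C J' x' f := by
  have h : ∀ σ, energy C J x σ = energy C J' x' σ := fun σ => by
    unfold energy
    congr 1
    · refine Finset.sum_congr rfl fun a ha => Finset.sum_congr rfl fun b hb => ?_
      split_ifs with hab
      · rw [hJ a ha b hb hab]
      · rfl
    · refine Finset.sum_congr rfl fun a ha => ?_
      rw [hx a ha]
  simp only [ev, h]

lemma mag_congr {C : Finset V} {J J' : Sym2 V → ℝ} {x x' : V → ℝ}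
    (hJ : ∀ a ∈ C, ∀ b ∈ C, a < b → J s(a, b) = J' s(a, b)) (hx : ∀ a ∈ C, x a = x' a)
    (j : V) : mag C J x j = mag C J' x' j := ev_congr hJ hx _

lemma cov_congr {C : Finset V} {J J' : Sym2 V → ℝ} {x x' : V → ℝ}
    (hJ : ∀ a ∈ C, ∀ b ∈ C, a < b → J s(a, b) = J' s(a, b)) (hx : ∀ a ∈ C, x a = x' a)
    (j k : V) : cov C J x j k = cov C J' x' j k := by
  simp only [cov, mag_congr hJ hx, ev_congr hJ hx]

lemma cum3_congr {C : Finset V} {J J' : Sym2 V → ℝ} {x x' : V → ℝ}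
    (hJ : ∀ a ∈ C, ∀ b ∈ C, a < b → J s(a, b) = J' s(a, b)) (hx : ∀ a ∈ C, x a = x' a)
    (j k l : V) : cum3 C J x j k l = cum3 C J' x' j k l := by
  simp only [cum3, mag_congr hJ hx, ev_congr hJ hx]

/-- The hypothesis `hS` says that `f` reads its second argument only on `S` and its first only off
`S`; the two arguments may then be taken independent. -/
lemma integral_resample {ι : Type*} [Fintype ι] (v : ℝ≥0) (S : Set ι) [DecidablePred (· ∈ S)]
    {f : (ι → ℝ) → (ι → ℝ) → ℝ} (hf : Continuous fun q : (ι → ℝ) × (ι → ℝ) => f q.1 q.2)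
    (hS : ∀ z y, f (S.piecewise y z) (S.piecewise y z) = f z y) :
    ∫ z, f z z ∂(gaussianPi ι v)
      = ∫ q, f q.1 q.2 ∂((gaussianPi ι v).prod (gaussianPi ι v)) := by
  have hp := measurePreserving_piecewise (gaussianReal 0 v) S
  change ∫ z, f z z ∂(Measure.pi fun _ => gaussianReal 0 v) = _
  have hd : Continuous fun z : ι → ℝ => f z z := hf.comp (continuous_id.prodMk continuous_id)
  rw [← hp.map_eq, integral_map hp.measurable.aemeasurable hd.aestronglyMeasurable]
  exact integral_congr_ae (Filter.Eventually.of_forall fun q => hS q.1 q.2)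

variable {C : Finset V} {i : V} (x : V → ℝ)

lemma piecewise_apply_of_notMem (hi : i ∉ C) (J y : Sym2 V → ℝ)
    [DecidablePred (· ∈ {e : Sym2 V | i ∈ e})] {a b : V} (ha : a ∈ C) (hb : b ∈ C) :
    {e : Sym2 V | i ∈ e}.piecewise y J s(a, b) = J s(a, b) := by
  refine Set.piecewise_eq_of_notMem _ _ _ fun h => ?_
  rcases Sym2.mem_iff.1 h with rfl | rfl
  · exact hi ha
  · exact hi hb

lemma shift_piecewise (J y : Sym2 V → ℝ) [DecidablePred (· ∈ {e : Sym2 V | i ∈ e})] (c : ℝ) :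
    shift i c ({e : Sym2 V | i ∈ e}.piecewise y J) x = shift i c y x := by
  ext l
  simp only [shift]
  rw [Set.piecewise_eq_of_mem _ _ _ (by simp)]

lemma magDiff_piecewise (hi : i ∉ C) (J y : Sym2 V → ℝ) [DecidablePred (· ∈ {e : Sym2 V | i ∈ e})]
    (j : V) : magDiff C ({e : Sym2 V | i ∈ e}.piecewise y J) x i
      ({e : Sym2 V | i ∈ e}.piecewise y J) j = magDiff C J x i y j := by
  have hJ : ∀ a ∈ C, ∀ b ∈ C, a < b → ({e : Sym2 V | i ∈ e}.piecewise y J) s(a, b) = J s(a, b) :=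
    fun a ha b hb _ => piecewise_apply_of_notMem hi J y ha hb
  simp only [magDiff, shift_piecewise, mag_congr hJ fun _ _ => rfl]

lemma covDiff_piecewise (hi : i ∉ C) (J y : Sym2 V → ℝ) [DecidablePred (· ∈ {e : Sym2 V | i ∈ e})]
    (j k : V) : covDiff C ({e : Sym2 V | i ∈ e}.piecewise y J) x i
      ({e : Sym2 V | i ∈ e}.piecewise y J) j k = covDiff C J x i y j k := by
  have hJ : ∀ a ∈ C, ∀ b ∈ C, a < b → ({e : Sym2 V | i ∈ e}.piecewise y J) s(a, b) = J s(a, b) :=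
    fun a ha b hb _ => piecewise_apply_of_notMem hi J y ha hb
  simp only [covDiff, shift_piecewise, cov_congr hJ fun _ _ => rfl]

lemma shift_neg (c : ℝ) (y : Sym2 V → ℝ) : shift i c (-y) x = shift i (-c) y x := by
  ext l
  simp [shift]

lemma magDiff_neg (J y : Sym2 V → ℝ) (j : V) :
    magDiff C J x i (-y) j = - magDiff C J x i y j := by
  simp only [magDiff, shift_neg, neg_neg]
  ring

lemma covDiff_neg (J y : Sym2 V → ℝ) (j k : V) :
    covDiff C J x i (-y) j k = - covDiff C J x i y j k := by
  simp only [covDiff, shift_neg, neg_neg]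
  ring

lemma continuous_shift (i : V) (c : ℝ) :
    Continuous fun q : (Sym2 V → ℝ) × (Sym2 V → ℝ) => (q.1, shift i c q.2 x) := by
  refine continuous_fst.prodMk (continuous_pi fun l => ?_)
  simp only [shift]
  fun_prop

lemma continuous_mag_shift (C : Finset V) (i : V) (c : ℝ) (j : V) :
    Continuous fun q : (Sym2 V → ℝ) × (Sym2 V → ℝ) => mag C q.1 (shift i c q.2 x) j := by
  have h := (continuous_mag C j).comp (continuous_shift x i c)
  simpa only [Function.comp_def] using h

lemma continuous_cov_shift (C : Finset V) (i : V) (c : ℝ) (j k : V) :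
    Continuous fun q : (Sym2 V → ℝ) × (Sym2 V → ℝ) => cov C q.1 (shift i c q.2 x) j k := by
  have h := (continuous_cov C j k).comp (continuous_shift x i c)
  simpa only [Function.comp_def] using h

lemma continuous_cum3_shift (C : Finset V) (i : V) (c : ℝ) (j k l : V) :
    Continuous fun q : (Sym2 V → ℝ) × (Sym2 V → ℝ) => cum3 C q.1 (shift i c q.2 x) j k l := by
  have h := (continuous_cum3 C j k l).comp (continuous_shift x i c)
  simpa only [Function.comp_def] using h

lemma continuous_magDiff (C : Finset V) (i j : V) :
    Continuous fun q : (Sym2 V → ℝ) × (Sym2 V → ℝ) => magDiff C q.1 x i q.2 j :=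
  continuous_const.mul ((continuous_mag_shift x C i 1 j).sub (continuous_mag_shift x C i (-1) j))

lemma continuous_covDiff (C : Finset V) (i j k : V) :
    Continuous fun q : (Sym2 V → ℝ) × (Sym2 V → ℝ) => covDiff C q.1 x i q.2 j k :=
  continuous_const.mul
    ((continuous_cov_shift x C i 1 j k).sub (continuous_cov_shift x C i (-1) j k))

lemma injOn_mk_left (i : V) (s : Set V) : Set.InjOn (fun l => s(i, l)) s :=
  fun _ _ _ _ h => Sym2.congr_right.1 h

end Resampling


variable {V : Type*} [Fintype V] [LinearOrder V]

/-! ### Power identities and comparison of moments -/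

section Rpow

lemma abs_mul_abs_rpow_sq {p : ℝ} (hp : 2 < p) (a : ℝ) :
    (a * |a| ^ (p / 2 - 1)) ^ 2 = |a| ^ p := by
  rw [mul_pow, ← sq_abs a, ← Real.rpow_natCast, ← Real.rpow_natCast, ← Real.rpow_mul (abs_nonneg _),
    ← Real.rpow_add_of_nonneg (abs_nonneg _) (by norm_num) (by push_cast; linarith)]
  congr 1
  push_cast
  ring

lemma abs_rpow_half_sq {p : ℝ} (a : ℝ) :
    (|a| ^ (p / 2 - 1)) ^ 2 = |a| ^ (p - 2) := by
  rw [← Real.rpow_natCast, ← Real.rpow_mul (abs_nonneg _)]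
  congr 1
  push_cast
  ring

lemma sq_le_one_add_abs_rpow {p : ℝ} (hp : 2 ≤ p) (u : ℝ) : u ^ 2 ≤ 1 + |u| ^ p := by
  rcases le_total |u| 1 with h | h
  · have h1 := (sq_le_one_iff_abs_le_one u).2 h
    have h2 := Real.rpow_nonneg (abs_nonneg u) p
    linarith
  · have := Real.rpow_le_rpow_of_exponent_le h hp
    rw [Real.rpow_two, sq_abs] at this
    linarith

lemma sq_mul_sq_le_of_abs_le_one {p : ℝ} (hp : p ≤ 4) {a b : ℝ} (ha : |a| ≤ 1)
    (hb : |b| ≤ 1) : (a * b) ^ 2 ≤ 2⁻¹ * (|a| ^ p + |b| ^ p) := by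
  have h : ∀ c : ℝ, |c| ≤ 1 → c ^ 4 ≤ |c| ^ p := by
    intro c hc
    have : |c| ^ (4 : ℝ) ≤ |c| ^ p :=
      by
      rcases eq_or_ne c 0 with rfl | h0
      · simpa using Real.rpow_nonneg (le_refl (0 : ℝ)) p
      · exact Real.rpow_le_rpow_of_exponent_ge (abs_pos.2 h0) hc hp
    have h4 : |c| ^ (4 : ℝ) = c ^ 4 := by
      rw [show (4 : ℝ) = ((4 : ℕ) : ℝ) by norm_num, Real.rpow_natCast]
      exact Even.pow_abs (by decide) c
    linarith
  have := h a ha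
  have := h b hb
  nlinarith [sq_nonneg (a ^ 2 - b ^ 2)]

end Rpow

/-! ### Moments of the magnetization difference -/

section Moments

variable {C : Finset V} {i : V} (x : V → ℝ) (v : ℝ≥0)

/-- The law of the couplings together with an independent copy. -/
abbrev pairLaw (V : Type*) [Fintype V] [DecidableEq V] (v : ℝ≥0) :
    Measure ((Sym2 V → ℝ) × (Sym2 V → ℝ)) :=
  (gaussianPi (Sym2 V) v).prod (gaussianPi (Sym2 V) v)

lemma integral_pairLaw_le {f : (Sym2 V → ℝ) × (Sym2 V → ℝ) → ℝ} {b : ℝ}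
    (hf : Integrable f (pairLaw V v)) (h : ∀ y, ∫ J, f (J, y) ∂(gaussianPi (Sym2 V) v) ≤ b) :
    ∫ q, f q ∂(pairLaw V v) ≤ b := by
  rw [integral_prod_symm _ hf]
  refine (integral_mono hf.integral_prod_right (integrable_const b) h).trans ?_
  simp

lemma integrable_abs_rpow_of_continuous {α : Type*} [TopologicalSpace α] [MeasurableSpace α]
    [OpensMeasurableSpace α] [SecondCountableTopology α] {μ : Measure α} [IsFiniteMeasure μ]
    {f : α → ℝ} (hf : Continuous f) {M p : ℝ} (hp : 0 ≤ p) (hM : ∀ a, |f a| ≤ M) :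
    Integrable (fun a => |f a| ^ p) μ :=
  integrable_of_continuous_of_abs_le (hf.abs.rpow_const fun _ => Or.inr hp) (M := M ^ p) fun a => by
    rw [abs_of_nonneg (by positivity)]
    exact Real.rpow_le_rpow (abs_nonneg _) (hM a) hp

lemma integral_half_add_le {α : Type*} [MeasurableSpace α] {μ : Measure α} {f g : α → ℝ} {β : ℝ}
    (hf : Integrable f μ) (hg : Integrable g μ) (hfβ : ∫ a, f a ∂μ ≤ β) (hgβ : ∫ a, g a ∂μ ≤ β) :
    ∫ a, (2⁻¹ * f a + 2⁻¹ * g a) ∂μ ≤ β := by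
  rw [integral_add (hf.const_mul _) (hg.const_mul _), integral_const_mul, integral_const_mul]
  linarith

/-- The Poincaré inequality for the `p`-th moment of the magnetization difference. -/
lemma integral_abs_magDiff_rpow_le_sum {p : ℝ} (hp : 2 < p) (hp4 : p ≤ 4) (j : V) :
    ∫ q, |magDiff C q.1 x i q.2 j| ^ p ∂(pairLaw V v)
      ≤ Real.pi ^ 2 / 8 * v * ∑ l ∈ C, ∫ q, (p / 2) ^ 2 * (|magDiff C q.1 x i q.2 j| ^ (p - 2)
        * (2⁻¹ * (cov C q.1 (shift i 1 q.2 x) j l + cov C q.1 (shift i (-1) q.2 x) j l)) ^ 2)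
          ∂(pairLaw V v) := by
  have hr : 0 < p / 2 - 1 := by linarith
  have hD := continuous_magDiff x C i j
  have hw : ∀ l, Continuous fun q : (Sym2 V → ℝ) × (Sym2 V → ℝ) =>
      2⁻¹ * (cov C q.1 (shift i 1 q.2 x) j l + cov C q.1 (shift i (-1) q.2 x) j l) := fun l =>
    continuous_const.mul
      ((continuous_cov_shift x C i 1 j l).add (continuous_cov_shift x C i (-1) j l))
  have hwM : ∀ l (J y : Sym2 V → ℝ),
      |2⁻¹ * (cov C J (shift i 1 y x) j l + cov C J (shift i (-1) y x) j l)| ≤ 2 := by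
    intro l J y
    have h1 := abs_le.1 (abs_cov_le C J (shift i 1 y x) j l)
    have h2 := abs_le.1 (abs_cov_le C J (shift i (-1) y x) j l)
    rw [abs_le]
    constructor <;> linarith
  have hDr : ∀ J y : Sym2 V → ℝ, |magDiff C J x i y j| ^ (p / 2 - 1) ≤ 1 := fun J y =>
    Real.rpow_le_one (abs_nonneg _) (abs_magDiff_le C J x i y j) hr.le
  -- The square of the signed power is `|D|^p`, and the square of its derivative is `(p/2)²
  -- |D|^(p-2)`.
  have h := gaussianPi_prod_poincare v C (e := fun l => s(i, l)) (injOn_mk_left i _)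
    (F := fun J y => magDiff C J x i y j * |magDiff C J x i y j| ^ (p / 2 - 1))
    (u := fun l J y => (1 + (p / 2 - 1)) * |magDiff C J x i y j| ^ (p / 2 - 1)
      * (2⁻¹ * (cov C J (shift i 1 y x) j l + cov C J (shift i (-1) y x) j l)))
    (M := 4) ?_ ?_ ?_ ?_ ?_ ?_
  · simp only [abs_mul_abs_rpow_sq hp] at h
    refine h.trans_eq ?_
    congr 1
    refine Finset.sum_congr rfl fun l _ => integral_congr_ae (Filter.Eventually.of_forall fun q => ?_)
    simp only [mul_pow, abs_rpow_half_sq]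
    ring
  · intro J y
    refine ((hasDerivAt_mul_abs_rpow hr _).comp_hasFDerivAt y
      (hasFDerivAt_magDiff C J x i j y)).congr_fderiv ?_
    rw [Finset.smul_sum]
    refine Finset.sum_congr rfl fun l _ => ?_
    rw [smul_smul]
  · exact hD.mul (hD.abs.rpow_const fun _ => Or.inr hr.le)
  · intro l _
    exact (continuous_const.mul (hD.abs.rpow_const fun _ => Or.inr hr.le)).mul (hw l)
  · intro l _ J y
    rw [abs_mul, abs_mul, abs_of_pos (by linarith : 0 < 1 + (p / 2 - 1)),
      abs_of_nonneg (Real.rpow_nonneg (abs_nonneg (magDiff C J x i y j)) _)]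
    have h1 : (1 + (p / 2 - 1)) * |magDiff C J x i y j| ^ (p / 2 - 1) ≤ 2 := by
      nlinarith [hDr J y, Real.rpow_nonneg (abs_nonneg (magDiff C J x i y j)) (p / 2 - 1)]
    calc _ ≤ (2 : ℝ) * 2 := mul_le_mul h1 (hwM l J y) (abs_nonneg _) (by norm_num)
      _ = 4 := by norm_num
  · intro J y
    rw [abs_mul, abs_of_nonneg (Real.rpow_nonneg (abs_nonneg (magDiff C J x i y j)) _)]
    have := mul_le_one₀ (abs_magDiff_le C J x i y j)
      (Real.rpow_nonneg (abs_nonneg (magDiff C J x i y j)) _) (hDr J y)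
    linarith
  · intro J y
    simp only [magDiff_neg, abs_neg, neg_mul]

/-- The pointwise bound of the gradient term by `p`-th powers. -/
lemma sum_abs_rpow_mul_sq_le {p n : ℝ} (hp : 2 < p) (hn : (C.card : ℝ) ≤ n) (hn1 : 1 ≤ n)
    {j : V} (J y : Sym2 V → ℝ) :
    ∑ l ∈ C, |magDiff C J x i y j| ^ (p - 2)
        * (2⁻¹ * (cov C J (shift i 1 y x) j l + cov C J (shift i (-1) y x) j l)) ^ 2
      ≤ 2 * n * (1 - 2 / p) * |magDiff C J x i y j| ^ p + 2 / p * (n * n ^ (-(p / 2))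
        + ∑ l ∈ C.erase j, (2⁻¹ * |cov C J (shift i 1 y x) j l| ^ p
          + 2⁻¹ * |cov C J (shift i (-1) y x) j l| ^ p)) := by
  have hp0 : 0 < p := by linarith
  have hn0 : 0 < n := by linarith
  set D := |magDiff C J x i y j| with hD
  have hD0 : 0 ≤ D := abs_nonneg _
  have h2p : 0 ≤ 1 - 2 / p := by
    rw [sub_nonneg, div_le_one hp0]; exact hp.le
  -- The term `l = j` is only bounded by 1. Young against `n^(-1/2)`, multiplied by `n`, costs `n ·
  -- n^(-p/2)`, the same order as the whole off-diagonal sum. It also adds a second `n` to the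
  -- coefficient of `D^p`.
  have hdiag : D ^ (p - 2)
        * (2⁻¹ * (cov C J (shift i 1 y x) j j + cov C J (shift i (-1) y x) j j)) ^ 2
      ≤ n * ((1 - 2 / p) * D ^ p) + 2 / p * (n * n ^ (-(p / 2))) := by
    have h1 := abs_le.1 (abs_cov_self_le C J (shift i 1 y x) j)
    have h2 := abs_le.1 (abs_cov_self_le C J (shift i (-1) y x) j)
    have hw : (2⁻¹ * (cov C J (shift i 1 y x) j j + cov C J (shift i (-1) y x) j j)) ^ 2 ≤ 1 := by
      rw [sq_le_one_iff_abs_le_one, abs_le]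
      constructor <;> linarith
    have hy := abs_rpow_mul_sq_le hp (magDiff C J x i y j) (n ^ (-(1 / 2 : ℝ)))
    have e1 : (n ^ (-(1 / 2 : ℝ))) ^ 2 = n⁻¹ := by
      rw [← Real.rpow_natCast, ← Real.rpow_mul hn0.le, ← Real.rpow_neg_one]
      norm_num
    have e2 : |n ^ (-(1 / 2 : ℝ))| ^ p = n ^ (-(p / 2)) := by
      rw [abs_of_pos (by positivity), ← Real.rpow_mul hn0.le]
      congr 1
      ring
    rw [e1, e2, ← hD] at hy
    calc _ ≤ D ^ (p - 2) * 1 := mul_le_mul_of_nonneg_left hw (by positivity)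
      _ = n * (D ^ (p - 2) * n⁻¹) := by field_simp
      _ ≤ n * ((1 - 2 / p) * D ^ p + 2 / p * n ^ (-(p / 2))) :=
        mul_le_mul_of_nonneg_left hy hn0.le
      _ = _ := by ring
  have hoff : ∀ l ∈ C.erase j, D ^ (p - 2)
        * (2⁻¹ * (cov C J (shift i 1 y x) j l + cov C J (shift i (-1) y x) j l)) ^ 2
      ≤ (1 - 2 / p) * D ^ p + 2 / p * (2⁻¹ * |cov C J (shift i 1 y x) j l| ^ p
          + 2⁻¹ * |cov C J (shift i (-1) y x) j l| ^ p) := by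
    intro l _
    refine (abs_rpow_mul_sq_le hp (magDiff C J x i y j) _).trans ?_
    exact add_le_add le_rfl
      (mul_le_mul_of_nonneg_left (abs_half_add_rpow_le (by linarith) _ _) (by positivity))
  have hcard : ((C.erase j).card : ℝ) ≤ n :=
    le_trans (by exact_mod_cast Finset.card_le_card (Finset.erase_subset j C)) hn
  have hDp : 0 ≤ (1 - 2 / p) * D ^ p := by positivity
  have hsum : _ ≤ ((C.erase j).card : ℝ) * ((1 - 2 / p) * D ^ p) + 2 / p *
      ∑ l ∈ C.erase j, (2⁻¹ * |cov C J (shift i 1 y x) j l| ^ p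
        + 2⁻¹ * |cov C J (shift i (-1) y x) j l| ^ p) :=
    (Finset.sum_le_sum hoff).trans_eq (by
      rw [Finset.sum_add_distrib, Finset.sum_const, nsmul_eq_mul, ← Finset.mul_sum])
  have hmul := mul_le_mul_of_nonneg_right hcard hDp
  by_cases hj : j ∈ C
  · rw [← Finset.add_sum_erase C _ hj]
    linarith
  · rw [Finset.erase_eq_of_notMem hj] at *
    have : 0 ≤ n * ((1 - 2 / p) * D ^ p) := by positivity
    have : 0 ≤ 2 / p * (n * n ^ (-(p / 2))) := by positivity
    linarith

/-- Closing the recursion: the right side is at most `0.86 (0.0202 X + 1.01 · 11 b)`. The `X` term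
is absorbed, and `0.86 · 1.01 · 11 < 9.56` leaves room below 10. -/
lemma le_of_poincare_recursion {p n c b X : ℝ} (hp : 2 < p) (hp' : p ≤ 2.02) (hn1 : 1 ≤ n)
    (hb : 0 ≤ b) (hcn : c * n ≤ 0.86) (hX : 0 ≤ X)
    (h : X ≤ c * ((p / 2) ^ 2
      * (2 * n * (1 - 2 / p) * X + 2 / p * (n * b + n * (10 * b))))) : X ≤ 10 * b := by
  have hp0 : 0 < p := by linarith
  have h2 : c * ((p / 2) ^ 2 * (2 * n * (1 - 2 / p) * X + 2 / p * (n * b + n * (10 * b))))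
      = (c * n) * (p * (p - 2) / 2 * X + p / 2 * (11 * b)) := by
    field_simp
    ring
  rw [h2] at h
  have h0 : 0 ≤ p * (p - 2) / 2 := by nlinarith
  have h1 : p * (p - 2) / 2 ≤ 0.0202 := by nlinarith
  have h3 : p * (p - 2) / 2 * X + p / 2 * (11 * b) ≤ 0.0202 * X + 1.01 * (11 * b) :=
    add_le_add (mul_le_mul_of_nonneg_right h1 hX)
      (mul_le_mul_of_nonneg_right (by linarith) (by positivity))
  have h4 : 0 ≤ p * (p - 2) / 2 * X + p / 2 * (11 * b) := by positivity
  have h5 := mul_le_mul_of_nonneg_right hcn h4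
  linarith

/-- The moment bound for the magnetization difference, given moment bounds for the covariances of
the system with one spin less. -/
lemma integral_abs_magDiff_rpow_le {p n : ℝ} (hp : 2 < p) (hp' : p ≤ 2.02)
    (hn : (C.card : ℝ) ≤ n) (hn1 : 1 ≤ n) (hv : Real.pi ^ 2 / 8 * v * n ≤ 0.86) {j : V}
    (hcov : ∀ x : V → ℝ, ∀ l ∈ C, j ≠ l →
      ∫ J, |cov C J x j l| ^ p ∂(gaussianPi (Sym2 V) v) ≤ 10 * n ^ (-(p / 2))) :
    ∫ q, |magDiff C q.1 x i q.2 j| ^ p ∂(pairLaw V v) ≤ 10 * n ^ (-(p / 2)) := by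
  have hp0 : 0 < p := by linarith
  have hn0 : 0 < n := by linarith
  set D : (Sym2 V → ℝ) × (Sym2 V → ℝ) → ℝ := fun q => |magDiff C q.1 x i q.2 j| with hD
  set w : V → (Sym2 V → ℝ) × (Sym2 V → ℝ) → ℝ := fun l q =>
    2⁻¹ * (cov C q.1 (shift i 1 q.2 x) j l + cov C q.1 (shift i (-1) q.2 x) j l) with hw
  set X := ∫ q, D q ^ p ∂(pairLaw V v) with hX
  have hDc : Continuous D := (continuous_magDiff x C i j).abs
  have hDi : Integrable (fun q => D q ^ p) (pairLaw V v) :=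
    integrable_abs_rpow_of_continuous (continuous_magDiff x C i j) hp0.le
      fun q => abs_magDiff_le C q.1 x i q.2 j
  have hci : ∀ c l, Integrable (fun q : (Sym2 V → ℝ) × (Sym2 V → ℝ) =>
      |cov C q.1 (shift i c q.2 x) j l| ^ p) (pairLaw V v) := fun c l =>
    integrable_abs_rpow_of_continuous (continuous_cov_shift x C i c j l) hp0.le
      fun q => abs_cov_le C q.1 _ j l
  have hgi : ∀ l ∈ C, Integrable (fun q => D q ^ (p - 2) * w l q ^ 2) (pairLaw V v) := by
    intro l _
    have hwc : Continuous (w l) := continuous_const.mul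
      ((continuous_cov_shift x C i 1 j l).add (continuous_cov_shift x C i (-1) j l))
    refine integrable_of_continuous_of_abs_le
      ((hDc.rpow_const fun _ => Or.inr (by linarith)).mul (hwc.pow 2)) (M := 4) fun q => ?_
    have h1 := abs_le.1 (abs_cov_le C q.1 (shift i 1 q.2 x) j l)
    have h2 := abs_le.1 (abs_cov_le C q.1 (shift i (-1) q.2 x) j l)
    have h3 : w l q ^ 2 ≤ 4 := by
      have : |w l q| ≤ 2 := by
        rw [abs_le]
        constructor <;> simp only [hw] <;> linarith
      nlinarith [sq_abs (w l q), abs_nonneg (w l q)]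
    have h4 : D q ^ (p - 2) ≤ 1 :=
      Real.rpow_le_one (abs_nonneg _) (abs_magDiff_le C q.1 x i q.2 j) (by linarith)
    have h5 : 0 ≤ D q ^ (p - 2) := Real.rpow_nonneg (abs_nonneg _) _
    rw [abs_of_nonneg (by positivity)]
    nlinarith [sq_nonneg (w l q)]
  have hP := integral_abs_magDiff_rpow_le_sum (C := C) (i := i) x v hp (by linarith) j
  simp only [integral_const_mul] at hP
  rw [← Finset.mul_sum, ← integral_finsetSum _ hgi] at hP
  have hsi : Integrable (fun q : (Sym2 V → ℝ) × (Sym2 V → ℝ) =>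
      ∑ l ∈ C.erase j, (2⁻¹ * |cov C q.1 (shift i 1 q.2 x) j l| ^ p
          + 2⁻¹ * |cov C q.1 (shift i (-1) q.2 x) j l| ^ p)) (pairLaw V v) :=
    integrable_finsetSum _ fun l _ => ((hci 1 l).const_mul _).add ((hci (-1) l).const_mul _)
  have hY : ∫ q, ∑ l ∈ C, D q ^ (p - 2) * w l q ^ 2 ∂(pairLaw V v)
      ≤ 2 * n * (1 - 2 / p) * X + 2 / p * (n * n ^ (-(p / 2)) + n * (10 * n ^ (-(p / 2)))) := by
    have hi1 := hDi.const_mul (2 * n * (1 - 2 / p))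
    have hi2 : Integrable (fun q : (Sym2 V → ℝ) × (Sym2 V → ℝ) => n * n ^ (-(p / 2))
        + ∑ l ∈ C.erase j, (2⁻¹ * |cov C q.1 (shift i 1 q.2 x) j l| ^ p
          + 2⁻¹ * |cov C q.1 (shift i (-1) q.2 x) j l| ^ p)) (pairLaw V v) :=
      (integrable_const _).add hsi
    have hi3 := hi2.const_mul (2 / p)
    refine (integral_mono (integrable_finsetSum _ hgi) (hi1.add hi3)
      fun q => sum_abs_rpow_mul_sq_le x hp hn hn1 q.1 q.2).trans ?_
    rw [integral_add' hi1 hi3, integral_const_mul, integral_const_mul,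
      integral_add (integrable_const _) hsi, integral_const, probReal_univ, one_smul]
    refine add_le_add le_rfl (mul_le_mul_of_nonneg_left (add_le_add le_rfl ?_) (by positivity))
    rw [integral_finsetSum]
    swap
    · exact fun l _ => ((hci 1 l).const_mul _).add ((hci (-1) l).const_mul _)
    have hb : ∀ l ∈ C.erase j, ∫ q, (2⁻¹ * |cov C q.1 (shift i 1 q.2 x) j l| ^ p
          + 2⁻¹ * |cov C q.1 (shift i (-1) q.2 x) j l| ^ p) ∂(pairLaw V v)
        ≤ 10 * n ^ (-(p / 2)) := by
      intro l hl
      have hl' := Finset.mem_erase.1 hl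
      exact integral_half_add_le (hci 1 l) (hci (-1) l)
        (integral_pairLaw_le v (hci 1 l) fun y => hcov (shift i 1 y x) l hl'.2 hl'.1.symm)
        (integral_pairLaw_le v (hci (-1) l) fun y => hcov (shift i (-1) y x) l hl'.2 hl'.1.symm)
    refine (Finset.sum_le_sum hb).trans ?_
    rw [Finset.sum_const, nsmul_eq_mul]
    refine mul_le_mul_of_nonneg_right (le_trans ?_ hn) (by positivity)
    exact_mod_cast Finset.card_le_card (Finset.erase_subset j C)
  exact le_of_poincare_recursion hp hp' hn1 (by positivity) hv
    (integral_nonneg fun q => by positivity)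
    (hP.trans (mul_le_mul_of_nonneg_left (mul_le_mul_of_nonneg_left hY (by positivity))
      (by positivity)))

end Moments


/-! ### Inductive bounds for covariances and third cumulants -/

section Bounds

variable (v : ℝ≥0)

lemma continuous_diag : Continuous fun J : Sym2 V → ℝ => (J, J) :=
  continuous_id.prodMk continuous_id

lemma continuous_cov_left (B : Finset V) (x : V → ℝ) (j k : V) :
    Continuous fun J : Sym2 V → ℝ => cov B J x j k := by
  have h := (continuous_cov B j k).comp (continuous_id.prodMk (continuous_const (y := x)))
  simpa only [Function.comp_def, id] using h

lemma integral_abs_magDiff_diag {C : Finset V} {i : V} (hi : i ∉ C) (x : V → ℝ) {p : ℝ}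
    (hp : 0 ≤ p) (j : V) :
    ∫ J, |magDiff C J x i J j| ^ p ∂(gaussianPi (Sym2 V) v)
      = ∫ q, |magDiff C q.1 x i q.2 j| ^ p ∂(pairLaw V v) := by
  classical
  refine integral_resample v {e : Sym2 V | i ∈ e}
    (f := fun J y => |magDiff C J x i y j| ^ p)
    ((continuous_magDiff x C i j).abs.rpow_const fun _ => Or.inr hp) fun J y => ?_
  rw [magDiff_piecewise x hi]

lemma integral_covDiff_sq_diag {C : Finset V} {i : V} (hi : i ∉ C) (x : V → ℝ) (j k : V) :
    ∫ J, covDiff C J x i J j k ^ 2 ∂(gaussianPi (Sym2 V) v)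
      = ∫ q, covDiff C q.1 x i q.2 j k ^ 2 ∂(pairLaw V v) := by
  classical
  refine integral_resample v {e : Sym2 V | i ∈ e}
    (f := fun J y => covDiff C J x i y j k ^ 2) ((continuous_covDiff x C i j k).pow 2) fun J y => ?_
  rw [covDiff_piecewise x hi]

/-- The covariances of the spin system have small `p`-th moments, uniformly in the field. -/
theorem integral_abs_cov_rpow_le {p n : ℝ} (hp : 2 < p) (hp' : p ≤ 2.02)
    (hn1 : 1 ≤ n) (hv : Real.pi ^ 2 / 8 * v * n ≤ 0.86) (B : Finset V) (hn : (B.card : ℝ) ≤ n)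
    (x : V → ℝ) {j k : V} (hj : j ∈ B) (hjk : j ≠ k) :
    ∫ J, |cov B J x j k| ^ p ∂(gaussianPi (Sym2 V) v) ≤ 10 * n ^ (-(p / 2)) := by
  induction B using Finset.strongInduction generalizing x j k with
  | H B ih =>
    have hp0 : 0 ≤ p := by linarith
    obtain ⟨C, hjC, rfl⟩ : ∃ C, j ∉ C ∧ B = insert j C :=
      ⟨B.erase j, Finset.notMem_erase j B, (Finset.insert_erase hj).symm⟩
    have hCn : (C.card : ℝ) ≤ n :=
      le_trans (by exact_mod_cast Finset.card_le_card (Finset.subset_insert j C)) hn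
    have hA := integral_abs_magDiff_rpow_le (C := C) (i := j) x v hp hp' hCn hn1 hv (j := k)
      fun x' l hl hkl => by
        -- The claim needs only its first index among the interacting spins, so the covariance is
        -- flipped to put `l ∈ C` first; `k` need not lie in `C`.
        simp only [cov_comm C _ x' k l]
        exact ih C (Finset.ssubset_insert hjC) hCn x' hl hkl.symm
    rw [← integral_abs_magDiff_diag v hjC x hp0] at hA
    refine le_trans (integral_mono ?_ ?_ fun J => ?_) hA
    · exact integrable_abs_rpow_of_continuous (continuous_cov_left _ x j k) hp0
        fun J => abs_cov_le _ J x j k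
    · have h := (continuous_magDiff x C j k).comp continuous_diag
      exact integrable_abs_rpow_of_continuous (f := fun J => magDiff C J x j J k) h hp0
        fun J => abs_magDiff_le C J x j J k
    · exact Real.rpow_le_rpow (abs_nonneg _) (abs_cov_insert_le J x hjC hjk.symm) hp0

/-- Apply `u² ≤ 1 + |u|^p` to `u = √n · cov`; this gives `11 = 1 + 10`. -/
lemma integral_cov_sq_le {p n : ℝ} (hp : 2 < p) (hp' : p ≤ 2.02)
    (hn1 : 1 ≤ n) (hv : Real.pi ^ 2 / 8 * v * n ≤ 0.86) (B : Finset V) (hn : (B.card : ℝ) ≤ n)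
    (x : V → ℝ) {j k : V} (hj : j ∈ B) (hjk : j ≠ k) :
    ∫ J, cov B J x j k ^ 2 ∂(gaussianPi (Sym2 V) v) ≤ 11 * n⁻¹ := by
  have hn0 : 0 < n := by linarith
  have h := integral_abs_cov_rpow_le v hp hp' hn1 hv B hn x hj hjk
  have hi : Integrable (fun J => |cov B J x j k| ^ p) (gaussianPi (Sym2 V) v) :=
    integrable_abs_rpow_of_continuous (continuous_cov_left _ x j k) (by linarith)
        fun J => abs_cov_le _ J x j k
  have hi2 : Integrable (fun J => cov B J x j k ^ 2) (gaussianPi (Sym2 V) v) := by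
    refine integrable_of_continuous_of_abs_le ((continuous_cov_left _ x j k).pow 2) (M := 2 ^ 2)
      fun J => ?_
    rw [abs_pow]
    exact pow_le_pow_left₀ (abs_nonneg _) (abs_cov_le _ J x j k) 2
  have hpt : ∀ J, cov B J x j k ^ 2 ≤ n⁻¹ * (1 + n ^ (p / 2) * |cov B J x j k| ^ p) := by
    intro J
    have h1 := sq_le_one_add_abs_rpow hp.le (n ^ (1 / 2 : ℝ) * cov B J x j k)
    have e1 : (n ^ (1 / 2 : ℝ)) ^ 2 = n := by
      rw [← Real.rpow_natCast, ← Real.rpow_mul hn0.le]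
      norm_num
    have e2 : (n ^ (1 / 2 : ℝ)) ^ p = n ^ (p / 2) := by
      rw [← Real.rpow_mul hn0.le]
      congr 1
      ring
    rw [mul_pow, e1, abs_mul, Real.mul_rpow (abs_nonneg _) (abs_nonneg _),
      abs_of_pos (by positivity), e2] at h1
    rw [inv_mul_eq_div, le_div_iff₀ hn0]
    linarith
  refine (integral_mono hi2 (((integrable_const _).add (hi.const_mul _)).const_mul _) hpt).trans ?_
  rw [integral_const_mul, integral_add' (integrable_const _) (hi.const_mul _), integral_const_mul, integral_const,
    probReal_univ, one_smul, mul_comm 11]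
  refine mul_le_mul_of_nonneg_left ?_ (by positivity)
  have h2 := mul_le_mul_of_nonneg_left h (show 0 ≤ n ^ (p / 2) by positivity)
  have e3 : n ^ (p / 2) * (10 * n ^ (-(p / 2))) = 10 := by
    rw [Real.rpow_neg hn0.le]
    field_simp
  linarith

lemma integral_covDiff_sq_le_sum {C : Finset V} {i : V} (x : V → ℝ) (j k : V) :
    ∫ q, covDiff C q.1 x i q.2 j k ^ 2 ∂(pairLaw V v)
      ≤ Real.pi ^ 2 / 8 * v * ∑ l ∈ C, ∫ q, (2⁻¹ * (cum3 C q.1 (shift i 1 q.2 x) j k l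
        + cum3 C q.1 (shift i (-1) q.2 x) j k l)) ^ 2 ∂(pairLaw V v) := by
  refine gaussianPi_prod_poincare v C (e := fun l => s(i, l)) (injOn_mk_left i _)
    (F := fun J y => covDiff C J x i y j k)
    (u := fun l J y => 2⁻¹ * (cum3 C J (shift i 1 y x) j k l + cum3 C J (shift i (-1) y x) j k l))
    (M := 6) (fun J y => hasFDerivAt_covDiff C J x i j k y) (continuous_covDiff x C i j k)
    (fun l _ => continuous_const.mul ((continuous_cum3_shift x C i 1 j k l).add
      (continuous_cum3_shift x C i (-1) j k l))) (fun l _ J y => ?_)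
    (fun J y => (abs_covDiff_le C J x i y j k).trans (by norm_num))
    fun J y => covDiff_neg x J y j k
  have h1 := abs_le.1 (abs_cum3_le C J (shift i 1 y x) j k l)
  have h2 := abs_le.1 (abs_cum3_le C J (shift i (-1) y x) j k l)
  rw [abs_le]
  constructor <;> linarith

/-- The third cumulants of the spin system have small second moments, uniformly in the field. -/
theorem integral_cum3_sq_le {p n : ℝ} (hp : 2 < p) (hp' : p ≤ 2.02)
    (hn1 : 1 ≤ n) (hv : Real.pi ^ 2 / 8 * v * n ≤ 0.86) (B : Finset V) (hn : (B.card : ℝ) ≤ n)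
    (x : V → ℝ) {i j k : V} (hi : i ∈ B) (hj : j ∈ B) (hk : k ∈ B) (hij : i ≠ j) (hik : i ≠ k)
    (hjk : j ≠ k) :
    ∫ J, cum3 B J x i j k ^ 2 ∂(gaussianPi (Sym2 V) v) ≤ 10000 * n ^ (-(p / 2)) := by
  induction B using Finset.strongInduction generalizing x i j k with
  | H B ih =>
    have hp0 : 0 ≤ p := by linarith
    have hn0 : 0 < n := by linarith
    obtain ⟨C, hiC, rfl⟩ : ∃ C, i ∉ C ∧ B = insert i C :=
      ⟨B.erase i, Finset.notMem_erase i B, (Finset.insert_erase hi).symm⟩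
    have hCn : (C.card : ℝ) ≤ n :=
      le_trans (by exact_mod_cast Finset.card_le_card (Finset.subset_insert i C)) hn
    have hjC : j ∈ C := Finset.mem_of_mem_insert_of_ne hj hij.symm
    have hkC : k ∈ C := Finset.mem_of_mem_insert_of_ne hk hik.symm
    set b := n ^ (-(p / 2)) with hb
    have hb0 : 0 ≤ b := by positivity
    have hD : ∀ m ∈ C, ∫ J, |magDiff C J x i J m| ^ p ∂(gaussianPi (Sym2 V) v) ≤ 10 * b := by
      intro m hm
      rw [integral_abs_magDiff_diag v hiC x hp0]
      exact integral_abs_magDiff_rpow_le x v hp hp' hCn hn1 hv fun x' l _ hml =>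
        integral_abs_cov_rpow_le v hp hp' hn1 hv C hCn x' hm hml
    have hci : ∀ c l, Integrable (fun q : (Sym2 V → ℝ) × (Sym2 V → ℝ) =>
        cum3 C q.1 (shift i c q.2 x) j k l ^ 2) (pairLaw V v) := fun c l =>
      integrable_of_continuous_of_abs_le ((continuous_cum3_shift x C i c j k l).pow 2) (M := 6 ^ 2)
        fun q => by
          rw [abs_pow]
          exact pow_le_pow_left₀ (abs_nonneg _) (abs_cum3_le _ _ _ _ _ _) 2
    have hpart : ∀ l β, (∀ x', ∫ J, cum3 C J x' j k l ^ 2 ∂(gaussianPi (Sym2 V) v) ≤ β) →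
        ∫ q, (2⁻¹ * (cum3 C q.1 (shift i 1 q.2 x) j k l
          + cum3 C q.1 (shift i (-1) q.2 x) j k l)) ^ 2 ∂(pairLaw V v) ≤ β := by
      intro l β hβ
      have hb1 := integral_pairLaw_le v (hci 1 l) fun y => hβ (shift i 1 y x)
      have hb2 := integral_pairLaw_le v (hci (-1) l) fun y => hβ (shift i (-1) y x)
      refine (integral_mono_of_nonneg (Filter.Eventually.of_forall fun q => sq_nonneg _)
        (((hci 1 l).const_mul 2⁻¹).add ((hci (-1) l).const_mul 2⁻¹))
        (Filter.Eventually.of_forall fun q => ?_)).trans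
          (integral_half_add_le (hci 1 l) (hci (-1) l) hb1 hb2)
      simp only [Pi.add_apply]
      nlinarith [sq_nonneg (cum3 C q.1 (shift i 1 q.2 x) j k l
        - cum3 C q.1 (shift i (-1) q.2 x) j k l)]
    have hdeg : ∀ m l, m ∈ C → m ≠ l → ∀ x' : V → ℝ,
        ∫ J, cum3 C J x' m l m ^ 2 ∂(gaussianPi (Sym2 V) v) ≤ 44 * n⁻¹ := by
      intro m l hm hml x'
      have h1 := integral_cov_sq_le v hp hp' hn1 hv C hCn x' hm hml
      have hi2 : Integrable (fun J => cov C J x' m l ^ 2) (gaussianPi (Sym2 V) v) := by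
        refine integrable_of_continuous_of_abs_le ((continuous_cov_left _ x' m l).pow 2)
          (M := 2 ^ 2) fun J => ?_
        rw [abs_pow]
        exact pow_le_pow_left₀ (abs_nonneg _) (abs_cov_le _ J x' m l) 2
      have hle : ∫ J, cum3 C J x' m l m ^ 2 ∂(gaussianPi (Sym2 V) v)
          ≤ ∫ J, 4 * cov C J x' m l ^ 2 ∂(gaussianPi (Sym2 V) v) := by
        refine integral_mono_of_nonneg (Filter.Eventually.of_forall fun q => sq_nonneg _)
          (hi2.const_mul 4) (Filter.Eventually.of_forall fun J => ?_)
        have hm1 := (sq_le_one_iff_abs_le_one _).2 (abs_mag_le C J x' m)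
        simp only [cum3_left]
        nlinarith [mul_le_mul_of_nonneg_right hm1 (sq_nonneg (cov C J x' m l))]
      rw [integral_const_mul] at hle
      linarith
    -- Poincaré for `covDiff`: the indices `l = j` and `l = k` are degenerate and cost `44/n` each,
    -- while the others fall under the induction hypothesis.
    have hcD : ∫ J, covDiff C J x i J j k ^ 2 ∂(gaussianPi (Sym2 V) v)
        ≤ 0.86 * (10000 * b + 88 * b) := by
      rw [integral_covDiff_sq_diag v hiC]
      refine (integral_covDiff_sq_le_sum v x j k).trans ?_
      have hkC' : k ∈ C.erase j := Finset.mem_erase.2 ⟨hjk.symm, hkC⟩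
      rw [← Finset.add_sum_erase C _ hjC, ← Finset.add_sum_erase (C.erase j) _ hkC']
      have hb1 := hpart j (44 * n⁻¹) (hdeg j k hjC hjk)
      have hb2 := hpart k (44 * n⁻¹) fun x' => by
        simp only [cum3_swap C _ x' j k k]
        exact hdeg k j hkC hjk.symm x'
      have hb3 : ∀ l ∈ (C.erase j).erase k, ∫ q, (2⁻¹ * (cum3 C q.1 (shift i 1 q.2 x) j k l
          + cum3 C q.1 (shift i (-1) q.2 x) j k l)) ^ 2 ∂(pairLaw V v) ≤ 10000 * b := by
        intro l hl
        obtain ⟨hlk, hl⟩ := Finset.mem_erase.1 hl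
        obtain ⟨hlj, hl⟩ := Finset.mem_erase.1 hl
        exact hpart l _ fun x' =>
          ih C (Finset.ssubset_insert hiC) hCn x' hjC hkC hl hjk hlj.symm hlk.symm
      have hb4 := Finset.sum_le_sum hb3
      rw [Finset.sum_const, nsmul_eq_mul] at hb4
      have hcard : (((C.erase j).erase k).card : ℝ) ≤ n :=
        le_trans (Nat.cast_le.2 (Finset.card_le_card
          ((Finset.erase_subset _ _).trans (Finset.erase_subset _ _)))) hCn
      have hb5 := mul_le_mul_of_nonneg_right hcard (show 0 ≤ 10000 * b by positivity)
      -- Holds because `p ≤ 4`: the two degenerate terms count as `88 n b`.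
      have hnb : n⁻¹ ≤ n * b := by
        rw [hb, ← Real.rpow_neg_one, ← Real.rpow_one_add' hn0.le (by linarith)]
        exact Real.rpow_le_rpow_of_exponent_le hn1 (by linarith)
      calc _ ≤ Real.pi ^ 2 / 8 * v * (n * (10000 * b + 88 * b)) :=
            mul_le_mul_of_nonneg_left (by linarith) (by positivity)
        _ = Real.pi ^ 2 / 8 * v * n * (10000 * b + 88 * b) := by ring
        _ ≤ _ := mul_le_mul_of_nonneg_right hv (by positivity)
    have hcDi : Integrable (fun J => covDiff C J x i J j k ^ 2) (gaussianPi (Sym2 V) v) := by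
      have h := ((continuous_covDiff x C i j k).comp continuous_diag).pow 2
      refine integrable_of_continuous_of_abs_le (f := fun J => covDiff C J x i J j k ^ 2) h
        (M := 2 ^ 2) fun J => ?_
      rw [abs_pow]
      exact pow_le_pow_left₀ (abs_nonneg _) (abs_covDiff_le C J x i J j k) 2
    have hDi : ∀ m, Integrable (fun J => |magDiff C J x i J m| ^ p) (gaussianPi (Sym2 V) v) := by
      intro m
      have h := (continuous_magDiff x C i m).comp continuous_diag
      exact integrable_abs_rpow_of_continuous (f := fun J => magDiff C J x i J m) h hp0
        fun J => abs_magDiff_le C J x i J m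
    -- From `(a + 2c)² ≤ 1.1 a² + 44 c²`, with `c²` at most half the sum of the two `p`-th powers.
    -- The weight `1.1` is chosen so that `1.1 · 0.86 < 1`.
    have hmaj := (hcDi.const_mul 1.1).add (((hDi j).add (hDi k)).const_mul 22)
    have hle : ∫ J, cum3 (insert i C) J x i j k ^ 2 ∂(gaussianPi (Sym2 V) v) ≤ _ :=
      integral_mono_of_nonneg (Filter.Eventually.of_forall fun J => sq_nonneg _) hmaj
        (Filter.Eventually.of_forall fun J => by
          simp only [Pi.add_apply]
          have h1 := abs_cum3_insert_le J x hiC hij.symm hik.symm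
          have h2 := sq_mul_sq_le_of_abs_le_one (p := p) (by linarith)
            (abs_magDiff_le C J x i J j) (abs_magDiff_le C J x i J k)
          have h3 := pow_le_pow_left₀ (abs_nonneg _) h1 2
          rw [sq_abs] at h3
          rw [← sq_abs (covDiff C J x i J j k)]
          rw [← sq_abs (magDiff C J x i J j * magDiff C J x i J k)] at h2
          nlinarith [sq_nonneg (0.1 * |covDiff C J x i J j k|
            - 2 * |magDiff C J x i J j * magDiff C J x i J k|)])
    rw [integral_add' (hcDi.const_mul 1.1) (((hDi j).add (hDi k)).const_mul 22),
      integral_const_mul, integral_const_mul, integral_add' (hDi j) (hDi k)] at hle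
    -- The constant closes because `1.1 · 0.86 · 10088 + 22 · 20 < 10000`.
    linarith [hD j hjC, hD k hkC]

end Bounds


/-! ### Centered third moments as cumulants -/

section Centered

variable (B : Finset V) (J : Sym2 V → ℝ) (x : V → ℝ)

lemma ev_add (f g : (V → Spin) → ℝ) :
    ev B J x (fun σ => f σ + g σ) = ev B J x f + ev B J x g := by
  simp only [ev, add_mul, Finset.sum_add_distrib, add_div]

lemma ev_const_mul (c : ℝ) (f : (V → Spin) → ℝ) :
    ev B J x (fun σ => c * f σ) = c * ev B J x f := by
  simp only [ev, mul_assoc, ← Finset.mul_sum, mul_div_assoc]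

lemma ev_centered_eq_cum3 (i j k : V) :
    ev B J x (fun σ => ((σ i).val - mag B J x i) * ((σ j).val - mag B J x j)
      * ((σ k).val - mag B J x k)) = cum3 B J x i j k := by
  set a := mag B J x i with ha
  set b := mag B J x j with hb
  set c := mag B J x k with hc
  have h : (fun σ : V → Spin => ((σ i).val - a) * ((σ j).val - b) * ((σ k).val - c))
      = fun σ => (σ i).val * (σ j).val * (σ k).val + (-a * ((σ j).val * (σ k).val)
        + (-b * ((σ i).val * (σ k).val) + (-c * ((σ i).val * (σ j).val)
        + (a * b * (σ k).val + (a * c * (σ j).val + (b * c * (σ i).val + -(a * b * c) * 1)))))) := by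
    ext σ
    ring
  have hm : ∀ l, ev B J x (fun σ => (σ l).val) = mag B J x l := fun l => rfl
  rw [h]
  simp only [ev_add, ev_const_mul, ev_one, hm, cum3, ← ha, ← hb, ← hc]
  ring

end Centered

/-! ### From the Hamiltonian with frozen spins to the general model -/

section Reduction

variable {N : ℕ} (g : Fin N → Fin N → ℝ) (h : ℝ) (A : Finset (Fin N)) (τ : Fixed A)

/-- The external field created by the frozen spins. -/
def frozenField (J : Sym2 (Fin N) → ℝ) : Fin N → ℝ :=
  fun l => h + ∑ j : {j : Fin N // j ∈ A}, J s(l, j.1) * (τ j).val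

/-- The restriction of a configuration to the complement of `A`. -/
def restrictConfig (σ : Fin N → Spin) : Config A := fun l => σ l.1

variable {g} {J : Sym2 (Fin N) → ℝ}

lemma energy_compl (hJ : ∀ a b, a ≠ b → g a b = J s(a, b)) (σ : Fin N → Spin) :
    energy Aᶜ J (frozenField h A τ J) σ = hamiltonian g h A τ (restrictConfig A σ) := by
  have hp : ∀ l, l ∈ Aᶜ ↔ l ∉ A := fun l => Finset.mem_compl
  unfold energy hamiltonian
  rw [Finset.sum_subtype Aᶜ hp, Finset.sum_subtype Aᶜ hp]
  congr 1
  · refine Finset.sum_congr rfl fun a _ => ?_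
    rw [Finset.sum_subtype Aᶜ hp]
    refine Finset.sum_congr rfl fun b _ => ?_
    split_ifs with hab
    · rw [hJ _ _ hab.ne]
      rfl
    · rfl
  · refine Finset.sum_congr rfl fun a _ => ?_
    simp only [frozenField, restrictConfig]
    congr 2
    refine Finset.sum_congr rfl fun b _ => ?_
    rw [hJ a.1 b.1 fun hab => a.2 (by rw [hab]; exact b.2)]

/-- The spins in `A` are free in the enlarged model, so each configuration is counted equally often;
the multiplicity cancels in Gibbs ratios. -/
lemma sum_restrictConfig (F : Config A → ℝ) :
    ∑ σ : Fin N → Spin, F (restrictConfig A σ)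
      = Fintype.card (Fixed A) * ∑ σ : Config A, F σ := by
  have h1 := Equiv.sum_comp (Equiv.piEquivPiSubtypeProd (fun l => l ∈ A) fun _ : Fin N => Spin)
    fun q => F q.2
  have h2 : ∑ q : Fixed A × Config A, F q.2 = Fintype.card (Fixed A) * ∑ σ : Config A, F σ := by
    rw [Fintype.sum_prod_type]
    simp
  exact h1.trans h2

lemma gibbs_eq_ev (hJ : ∀ a b, a ≠ b → g a b = J s(a, b)) (f : Config A → ℝ) :
    gibbs g h A τ f = ev Aᶜ J (frozenField h A τ J) fun σ => f (restrictConfig A σ) := by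
  simp only [gibbs, ev, energy_compl h A τ hJ]
  rw [sum_restrictConfig A fun σ => f σ * Real.exp (hamiltonian g h A τ σ),
    sum_restrictConfig A fun σ => Real.exp (hamiltonian g h A τ σ), mul_div_mul_left]
  exact_mod_cast Fintype.card_ne_zero

lemma threePoint_eq_cum3 (hJ : ∀ a b, a ≠ b → g a b = J s(a, b)) (i j k : {l : Fin N // l ∉ A}) :
    threePoint g h A τ i j k = cum3 Aᶜ J (frozenField h A τ J) i.1 j.1 k.1 := by
  rw [← ev_centered_eq_cum3]
  simp only [threePoint, magnetization, gibbs_eq_ev h A τ hJ]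
  rfl

end Reduction

/-! ### Independence of the frozen field -/

section FrozenField

variable {N : ℕ} (h : ℝ) (A : Finset (Fin N)) (τ : Fixed A)

lemma continuous_frozenField : Continuous (frozenField h A τ) := by
  refine continuous_pi fun l => ?_
  simp only [frozenField]
  fun_prop

/-- The third cumulant in the random field of the frozen spins, which is independent of the
couplings between the other spins. -/
theorem integral_cum3_frozenField_sq_le (v : ℝ≥0) {p n : ℝ} (hp : 2 < p) (hp' : p ≤ 2.02)
    (hn1 : 1 ≤ n) (hv : Real.pi ^ 2 / 8 * v * n ≤ 0.86) (hn : (N : ℝ) ≤ n)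
    {i j k : Fin N} (hi : i ∉ A) (hj : j ∉ A) (hk : k ∉ A) (hij : i ≠ j) (hik : i ≠ k)
    (hjk : j ≠ k) :
    ∫ J, cum3 Aᶜ J (frozenField h A τ J) i j k ^ 2 ∂(gaussianPi (Sym2 (Fin N)) v)
      ≤ 10000 * n ^ (-(p / 2)) := by
  classical
  have hc : Continuous fun q : (Sym2 (Fin N) → ℝ) × (Sym2 (Fin N) → ℝ) =>
      cum3 Aᶜ q.1 (frozenField h A τ q.2) i j k ^ 2 := by
    have h1 := (continuous_cum3 Aᶜ i j k).comp
      (continuous_fst.prodMk ((continuous_frozenField h A τ).comp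
        (continuous_snd (X := Sym2 (Fin N) → ℝ))))
    exact h1.pow 2
  -- The frozen field, at sites outside `A` as elsewhere, uses only pairs meeting `A`, and the
  -- interaction on `Aᶜ` only pairs avoiding `A`. After resampling, the field can be fixed.
  rw [integral_resample v {e : Sym2 (Fin N) | ∃ a ∈ A, a ∈ e}
    (f := fun z y => cum3 Aᶜ z (frozenField h A τ y) i j k ^ 2) hc fun z y => ?_]
  · have hint : Integrable (fun q : (Sym2 (Fin N) → ℝ) × (Sym2 (Fin N) → ℝ) =>
        cum3 Aᶜ q.1 (frozenField h A τ q.2) i j k ^ 2) (pairLaw (Fin N) v) :=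
      integrable_of_continuous_of_abs_le hc (M := 6 ^ 2) fun q => by
        rw [abs_pow]
        exact pow_le_pow_left₀ (abs_nonneg _) (abs_cum3_le _ _ _ _ _ _) 2
    have hcard : ((Aᶜ : Finset (Fin N)).card : ℝ) ≤ n := by
      refine le_trans ?_ hn
      exact_mod_cast (Finset.card_le_univ Aᶜ).trans_eq (Fintype.card_fin N)
    exact integral_pairLaw_le v hint fun y => integral_cum3_sq_le v hp hp' hn1 hv Aᶜ hcard
      (frozenField h A τ y) (Finset.mem_compl.2 hi) (Finset.mem_compl.2 hj)
      (Finset.mem_compl.2 hk) hij hik hjk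
  · have hx : frozenField h A τ ({e : Sym2 (Fin N) | ∃ a ∈ A, a ∈ e}.piecewise y z)
        = frozenField h A τ y := by
      ext l
      simp only [frozenField]
      congr 1
      refine Finset.sum_congr rfl fun b _ => ?_
      rw [Set.piecewise_eq_of_mem]
      exact ⟨b.1, b.2, Sym2.mem_mk_right _ _⟩
    have hz : ∀ a ∈ Aᶜ, ∀ b ∈ Aᶜ, a < b →
        {e : Sym2 (Fin N) | ∃ a ∈ A, a ∈ e}.piecewise y z s(a, b) = z s(a, b) := by
      intro a ha b hb _
      refine Set.piecewise_eq_of_notMem _ _ _ ?_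
      rintro ⟨c, hcA, hc⟩
      rcases Sym2.mem_iff.1 hc with rfl | rfl
      · exact Finset.mem_compl.1 ha hcA
      · exact Finset.mem_compl.1 hb hcA
    rw [hx, cum3_congr (x := frozenField h A τ y) (x' := frozenField h A τ y) hz fun _ _ => rfl]

end FrozenField

/-! ### Transfer from the given probability space to Gaussian integrals -/

section Transfer

variable {N : ℕ}

/-- The pairs `i < j` indexing the independent couplings. -/
abbrev OrdPair (N : ℕ) : Type := {p : Fin N × Fin N // p.1 < p.2}

/-- The symmetric matrix with zero diagonal and prescribed entries above the diagonal. -/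
def symMatrix (w : OrdPair N → ℝ) (a b : Fin N) : ℝ :=
  if hab : a < b then w ⟨(a, b), hab⟩ else if hba : b < a then w ⟨(b, a), hba⟩ else 0

lemma symMatrix_comm (w : OrdPair N → ℝ) (a b : Fin N) : symMatrix w a b = symMatrix w b a := by
  rcases lt_trichotomy a b with hab | rfl | hab
  · simp [symMatrix, hab, hab.not_gt]
  · rfl
  · simp [symMatrix, hab, hab.not_gt]

/-- The couplings as a function of unordered pairs. -/
def symCoupling (w : OrdPair N → ℝ) : Sym2 (Fin N) → ℝ :=
  Sym2.lift ⟨symMatrix w, symMatrix_comm w⟩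

lemma continuous_symCoupling : Continuous (symCoupling (N := N)) := by
  refine continuous_pi fun e => ?_
  induction e using Sym2.inductionOn with
  | hf a b =>
    simp only [symCoupling, Sym2.lift_mk, symMatrix]
    split_ifs <;> fun_prop

lemma pairToSym2_injective :
    Function.Injective fun p : OrdPair N => s(p.1.1, p.1.2) := by
  rintro ⟨⟨a, b⟩, hab⟩ ⟨⟨c, d⟩, hcd⟩ h
  rcases Sym2.eq_iff.1 h with ⟨rfl, rfl⟩ | ⟨rfl, rfl⟩
  · rfl
  · exact absurd hab hcd.not_gt

lemma symMatrix_comp (J : Sym2 (Fin N) → ℝ) {a b : Fin N} (hab : a ≠ b) :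
    symMatrix (fun p : OrdPair N => J s(p.1.1, p.1.2)) a b = J s(a, b) := by
  rcases lt_or_gt_of_ne hab with h | h
  · simp [symMatrix, h]
  · simp [symMatrix, h, h.not_gt, Sym2.eq_swap]

lemma IsCoupling.symMatrix_eq {Ω : Type*} [MeasurableSpace Ω] {P : Measure Ω} {t : ℝ}
    {g : Fin N → Fin N → Ω → ℝ} (hg : IsCoupling P t g) (ω : Ω) (a b : Fin N) :
    symMatrix (fun p : OrdPair N => g p.1.1 p.1.2 ω) a b = g a b ω := by
  rcases lt_trichotomy a b with hab | rfl | hab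
  · simp [symMatrix, hab]
  · simp [symMatrix, hg.diag]
  · simp [symMatrix, hab, hab.not_gt, hg.symm a b]

lemma IsCoupling.map_eq {Ω : Type*} [MeasurableSpace Ω] {P : Measure Ω} {t : ℝ}
    {g : Fin N → Fin N → Ω → ℝ} (hg : IsCoupling P t g) :
    P.map (fun ω (p : OrdPair N) => g p.1.1 p.1.2 ω)
      = gaussianPi (OrdPair N) (t / N).toNNReal := by
  rw [hg.indep.map_fun_eq_pi_map fun p => (hg.measurable _ _).aemeasurable]
  simp only [fun p : OrdPair N => hg.law p.1.1 p.1.2 p.2]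

/-- Expectations of the three-point function are Gaussian integrals of third cumulants. -/
lemma IsCoupling.integral_threePoint {Ω : Type*} [MeasurableSpace Ω] {P : Measure Ω} {t : ℝ}
    {g : Fin N → Fin N → Ω → ℝ} (hg : IsCoupling P t g) (h : ℝ) (A : Finset (Fin N))
    (τ : Fixed A) (i j k : {l : Fin N // l ∉ A}) :
    ∫ ω, |threePoint (fun a b => g a b ω) h A τ i j k| ^ 2 ∂P
      = ∫ J, cum3 Aᶜ J (frozenField h A τ J) i.1 j.1 k.1 ^ 2
          ∂(gaussianPi (Sym2 (Fin N)) (t / N).toNNReal) := by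
  set Ψ : (OrdPair N → ℝ) → ℝ := fun w => threePoint (symMatrix w) h A τ i j k ^ 2 with hΨ
  have hΨc : Continuous Ψ := by
    have hΨ' : Ψ = fun w => cum3 Aᶜ (symCoupling w) (frozenField h A τ (symCoupling w))
        i.1 j.1 k.1 ^ 2 := by
      ext w
      simp only [hΨ]
      rw [threePoint_eq_cum3 h A τ (g := symMatrix w) (J := symCoupling w) fun a b _ => rfl]
    rw [hΨ']
    have h1 := (continuous_cum3 Aᶜ i.1 j.1 k.1).comp (continuous_symCoupling.prodMk
      ((continuous_frozenField h A τ).comp continuous_symCoupling))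
    exact h1.pow 2
  have hw : Measurable fun ω (p : OrdPair N) => g p.1.1 p.1.2 ω :=
    measurable_pi_lambda _ fun p => hg.measurable _ _
  have h1 : ∫ ω, |threePoint (fun a b => g a b ω) h A τ i j k| ^ 2 ∂P
      = ∫ w, Ψ w ∂(gaussianPi (OrdPair N) (t / N).toNNReal) := by
    rw [← hg.map_eq, integral_map hw.aemeasurable hΨc.aestronglyMeasurable]
    refine integral_congr_ae (Filter.Eventually.of_forall fun ω => ?_)
    have : symMatrix (fun p : OrdPair N => g p.1.1 p.1.2 ω) = fun a b => g a b ω := by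
      ext a b
      exact hg.symMatrix_eq ω a b
    simp only [hΨ, this, sq_abs]
  -- The family on `Sym2` also has diagonal coordinates, which the model never reads, so the extra
  -- variables are harmless.
  have hmp := measurePreserving_comp_injective (gaussianReal 0 (t / N).toNNReal)
    (pairToSym2_injective (N := N))
  rw [h1]
  change ∫ w, Ψ w ∂(Measure.pi fun _ => gaussianReal 0 (t / N).toNNReal) = _
  rw [← hmp.map_eq, integral_map hmp.measurable.aemeasurable hΨc.aestronglyMeasurable]
  refine integral_congr_ae (Filter.Eventually.of_forall fun J => ?_)
  simp only [hΨ]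
  rw [threePoint_eq_cum3 h A τ fun a b hab => symMatrix_comp J hab]

/-- The only place where `t < log 2` enters: `π²/8 · log 2 ≈ 0.855`. -/
lemma pi_sq_div_eight_mul_le {t : ℝ} (ht : t < Real.log 2) : Real.pi ^ 2 / 8 * t ≤ 0.86 := by
  have h1 := Real.pi_lt_d4
  have h2 := Real.log_two_lt_d9
  have h3 := Real.pi_pos
  have h4 : Real.pi ^ 2 ≤ 9.87 := by nlinarith
  nlinarith [sq_nonneg Real.pi]

end Transfer

end

end SK

theorem lemma3p2 :
    ∃ ε₀ : ℝ, 0 < ε₀ ∧ ∀ ε : ℝ, 0 < ε → ε < ε₀ →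
      ∃ C : ℝ, 0 < C ∧
        ∀ (t : ℝ), 0 ≤ t → t < Real.log 2 →
        ∀ (h : ℝ) (N : ℕ) (Ω : Type*) [MeasurableSpace Ω] (P : Measure Ω)
          [IsProbabilityMeasure P] (g : Fin N → Fin N → Ω → ℝ), SK.IsCoupling P t g →
        ∀ (A : Finset (Fin N)) (i j k : {x : Fin N // x ∉ A}), i ≠ j → i ≠ k → j ≠ k →
          (⨆ τ : SK.Fixed A,
              ∫ ω, |SK.threePoint (fun a b => g a b ω) h A τ i j k| ^ 2 ∂P)
            ≤ C / (N : ℝ) ^ (1 + ε / 2) := by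
  -- With `p = 2 + ε`, the threshold `0.02` is the condition `p ≤ 2.02`, and `n^(-p/2)` with `n = N`
  -- is the required rate.
  refine ⟨0.02, by norm_num, fun ε hε hε' => ⟨10000, by norm_num, ?_⟩⟩
  intro t ht0 ht h N Ω _ P _ g hg A i j k hij hik hjk
  have hN : 0 < N := i.1.pos
  have hN1 : (1 : ℝ) ≤ N := by exact_mod_cast hN
  have hN0 : (0 : ℝ) < N := by exact_mod_cast hN
  refine ciSup_le fun τ => ?_
  rw [hg.integral_threePoint h A τ i j k]
  have hv : Real.pi ^ 2 / 8 * ((t / N).toNNReal : ℝ) * N ≤ 0.86 := by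
    rw [Real.coe_toNNReal _ (by positivity), mul_assoc, div_mul_cancel₀ _ hN0.ne']
    exact SK.pi_sq_div_eight_mul_le ht
  have hmain := SK.integral_cum3_frozenField_sq_le h A τ (t / N).toNNReal (p := 2 + ε)
    (by linarith) (by linarith) hN1 hv le_rfl i.2 j.2 k.2 (Subtype.coe_ne_coe.2 hij)
    (Subtype.coe_ne_coe.2 hik) (Subtype.coe_ne_coe.2 hjk)
  refine hmain.trans_eq ?_
  rw [Real.rpow_neg hN0.le, div_eq_mul_inv]
  congr 3
  ring
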